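/- Let $\mathbb{K}$ be an algebraically closed field of characteristic zero and let $\mathcal{P}=(p_1:p_2:p_3:p_4):\mathbb{P}^2(\mathbb{K})\dashrightarrow\mathbb{P}^3(\mathbb{K})$ be a rational map (for instance, a rational parametrization of a surface), where the $p_i\in\mathbb{K}[t_1,t_2,t_3]$ are homogeneous of the same degree, $\gcd(p_1,p_2,p_3,p_4)=1$, and $p_i(0,0,1)\neq 0$ for $i=1,\dots,4$. Let $\mathscr{B}(\mathcal{P})\subset\mathbb{P}^2(\mathbb{K})$ be the set of base points, i.e. the common zeros of $p_1,\dots,p_4$. Let $x_1,\dots,x_4,y_1,\dots,y_4$ be indeterminates, let $\mathbb{F}$ be the algebraic closure of $\mathbb{K}(x_1,\dots,x_4,y_1,\dots,y_4)$, put $W_1=\sum_{i=1}^4 x_i p_i$ and $W_2=\sum_{i=1}^4 y_i p_i$, and define $$\operatorname{mult}(\mathscr{B}(\mathcal{P}))=\sum_{A\in\mathscr{B}(\mathcal{P})}\operatorname{mult}_A(W_1,W_2),\qquad \operatorname{mult}_A(W_1,W_2)=\dim_{\mathbb{F}}\mathcal{O}_{\mathbb{P}^2(\mathbb{F}),A}/\langle\widetilde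 W_1,\widetilde W_2\rangle,$$ where $\widetilde W_i$ is a local equation of the curve $W_i=0$ at $A$; this is the intersection multiplicity at $A$ of the two curves in $\mathbb{P}^2(\mathbb{F})$. Let $\mathscr{G}^\star$ be the set of projective transformations $L=(L_1:\dots:L_4)$ of $\mathbb{P}^3(\mathbb{K})$ that are represented by a matrix of the form $\begin{pmatrix}A&0\\0&1\end{pmatrix}$ with a $3\times 3$ block $A$, and for $L\in\mathscr{G}^\star$ put $$K_1^L=x_4L_1(\mathcal{P})-x_1L_4(\mathcal{P}),\qquad K_2^L=x_4L_3(\mathcal{P})-x_3L_4(\mathcal{P}).$$ Then there is a non-empty Zariski open subset $\Omega$ of $\mathscr{G}^\star$ such that for every $L\in\Omega$ we have $\operatorname{Res}_{t_3}(K_1^L,K_2^L)\neq 0$ and $$\operatorname{mult}(\mathscr{B}(\mathcal{P}))=\deg_{(t_1,t_2)}\Bigl(\operatorname{Content}_{x}\bigl(\operatorname{Res}_{t_3}(K_1^L,K_2^L)\bigr)\Bigr),$$ where $\operatorname{Content}_x$ of a polynomial in $\mathbb{K}[t_1,t_2][x_1,\dots,x_4]$ is the greatest common divisor in $\mathbb{K}[t_1,t_2]$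 of its coefficients with respect to $x_1,\dots,x_4$. -/

import Mathlib

noncomputable section

namespace BaseLocus

open MvPolynomial

/-! ### Intersection multiplicity of two plane projective curves -/

section Intersection

variable {F : Type*} [Field F]

/-- Dehomogenization with respect to the `j`-th coordinate (`t_j = 1`); the two remaining
coordinates, in increasing order, become the affine coordinates. -/
def dehomogenize (j : Fin 3) : MvPolynomial (Fin 3) F →ₐ[F] MvPolynomial (Fin 2) F :=
  aeval (j.insertNth 1 X : Fin 3 → MvPolynomial (Fin 2) F)

/-- The affine coordinates of the point `(a 0 : a 1 : a 2)` in the chart `t_j ≠ 0`. -/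
def affineCoord (j : Fin 3) (a : Fin 3 → F) : Fin 2 → F :=
  fun i => a (j.succAbove i) / a j

/-- The maximal ideal of the affine plane at the point `b`. -/
abbrev pointIdeal (b : Fin 2 → F) : Ideal (MvPolynomial (Fin 2) F) :=
  RingHom.ker (MvPolynomial.eval b)

instance pointIdeal_isPrime (b : Fin 2 → F) : (pointIdeal b).IsPrime :=
  RingHom.ker_isPrime _

/-- The local ring of the affine plane at the point `b`. -/
abbrev LocalRingAt (b : Fin 2 → F) : Type _ :=
  Localization.AtPrime (pointIdeal b)

/-- `dim_F 𝒪_{𝔸², b} / (f, g)`; the length of an `F`-vector space is its dimension, with value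
`⊤` if the dimension is infinite. -/
def affineIntersectionMultiplicity (f g : MvPolynomial (Fin 2) F) (b : Fin 2 → F) : ℕ∞ :=
  Module.length F (LocalRingAt b ⧸
    Ideal.span {algebraMap (MvPolynomial (Fin 2) F) (LocalRingAt b) f,
      algebraMap (MvPolynomial (Fin 2) F) (LocalRingAt b) g})

/-- A coordinate chart that contains the point with homogeneous coordinates `a`. -/
def chartIndex (a : Fin 3 → F) (ha : a ≠ 0) : Fin 3 :=
  (Function.ne_iff.mp ha).choose

theorem chartIndex_spec (a : Fin 3 → F) (ha : a ≠ 0) : a (chartIndex a ha) ≠ 0 :=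
  (Function.ne_iff.mp ha).choose_spec

/-- The intersection multiplicity `dim_F 𝒪_{ℙ², A} / (f̃, g̃)` of the curves defined by the forms
`f` and `g` at the point `A = (a 0 : a 1 : a 2)` of the projective plane over `F`. It is computed in
an affine chart around `A`; any chart around `A` gives the same value. -/
def intersectionMultiplicity (f g : MvPolynomial (Fin 3) F) (a : Fin 3 → F) (ha : a ≠ 0) : ℕ∞ :=
  affineIntersectionMultiplicity
    (dehomogenize (chartIndex a ha) f) (dehomogenize (chartIndex a ha) g)
    (affineCoord (chartIndex a ha) a)

end Intersection

/-! ### The base points and their multiplicity -/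

section BasePoints

variable {K : Type*} [Field K]

/-- The set of base points of `(p 0 : p 1 : p 2 : p 3)` in the projective plane over `K`. For
forms `p i`, the condition does not depend on the representative. -/
def basePoints (p : Fin 4 → MvPolynomial (Fin 3) K) : Set (Projectivization K (Fin 3 → K)) :=
  {A | ∀ i, eval A.rep (p i) = 0}

variable (K) in
/-- The algebraic closure of the field `K(x, y)` of rational functions in the eight indeterminates
`x = (x_1, …, x_4)` (left summand) and `y = (y_1, …, y_4)` (right summand). -/
abbrev GenericField : Type _ :=
  AlgebraicClosure (FractionRing (MvPolynomial (Fin 4 ⊕ Fin 4) K))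

variable (K) in
/-- The indeterminates `x_i` and `y_i` as elements of `GenericField K`. -/
def genericVar (s : Fin 4 ⊕ Fin 4) : GenericField K :=
  algebraMap (FractionRing (MvPolynomial (Fin 4 ⊕ Fin 4) K)) (GenericField K)
    (algebraMap (MvPolynomial (Fin 4 ⊕ Fin 4) K) _ (X s))

/-- `W_1 = ∑ x_i p_i`. -/
def W₁ (p : Fin 4 → MvPolynomial (Fin 3) K) : MvPolynomial (Fin 3) (GenericField K) :=
  ∑ i, C (genericVar K (Sum.inl i)) * map (algebraMap K (GenericField K)) (p i)

/-- `W_2 = ∑ y_i p_i`. -/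
def W₂ (p : Fin 4 → MvPolynomial (Fin 3) K) : MvPolynomial (Fin 3) (GenericField K) :=
  ∑ i, C (genericVar K (Sum.inr i)) * map (algebraMap K (GenericField K)) (p i)

/-- Homogeneous coordinates of a point of the plane over `K`, read in `GenericField K`. -/
def genericCoord (A : Projectivization K (Fin 3 → K)) : Fin 3 → GenericField K :=
  fun i => algebraMap K (GenericField K) (A.rep i)

theorem genericCoord_ne_zero (A : Projectivization K (Fin 3 → K)) : genericCoord A ≠ 0 := by
  intro h
  refine A.rep_nonzero (funext fun i => ?_)
  have hi : algebraMap K (GenericField K) (A.rep i) = 0 := congrFun h i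
  exact (map_eq_zero _).mp hi

/-- The multiplicity of intersection at `A` of the curves defined by `W_1` and `W_2`. -/
def basePointMultiplicity (p : Fin 4 → MvPolynomial (Fin 3) K)
    (A : Projectivization K (Fin 3 → K)) : ℕ∞ :=
  intersectionMultiplicity (W₁ p) (W₂ p) (genericCoord A) (genericCoord_ne_zero A)

/-- The multiplicity of the base point locus. The sum is taken in `ℕ∞`, where every family is
summable. -/
def baseLocusMultiplicity (p : Fin 4 → MvPolynomial (Fin 3) K) : ℕ∞ :=
  ∑' A : basePoints p, basePointMultiplicity p A

end BasePoints

/-! ### Projective transformations -/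

section Transformations

variable {K : Type*} [Field K]

variable (K) in
/-- The projective transformations of `ℙ³` that have a matrix of the form `diag(A, 1)` with a
`3 × 3` block `A`. -/
def GStar : Set (Matrix.ProjGenLinGroup (Fin 4) K) :=
  {g | ∃ M : GL (Fin 4) K, Matrix.ProjGenLinGroup.mk M = g ∧ M (Fin.last 3) (Fin.last 3) = 1 ∧
    ∀ i : Fin 3, M i.castSucc (Fin.last 3) = 0 ∧ M (Fin.last 3) i.castSucc = 0}

/-- Zariski open sets of projective transformations, as an open subset of the projective space of
`4 × 4` matrices: the complement is cut out by forms in the matrix entries. -/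
def IsZariskiOpen (U : Set (Matrix.ProjGenLinGroup (Fin 4) K)) : Prop :=
  ∃ S : Set (MvPolynomial (Fin 4 × Fin 4) K), (∀ f ∈ S, ∃ n, f.IsHomogeneous n) ∧
    ∀ M : GL (Fin 4) K, Matrix.ProjGenLinGroup.mk M ∈ U ↔
      ∃ f ∈ S, eval (fun ij : Fin 4 × Fin 4 => M ij.1 ij.2) f ≠ 0

/-- Relatively Zariski open subsets of `GStar K`. -/
def IsZariskiOpenInGStar (Ω : Set (Matrix.ProjGenLinGroup (Fin 4) K)) : Prop :=
  ∃ U : Set (Matrix.ProjGenLinGroup (Fin 4) K), IsZariskiOpen U ∧ Ω = U ∩ GStar K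

/-- The `i`-th component `L_i(p_1, …, p_4)` of the transformed map, `L` having matrix `M`. -/
def transformed (M : GL (Fin 4) K) (p : Fin 4 → MvPolynomial (Fin 3) K) (i : Fin 4) :
    MvPolynomial (Fin 3) K :=
  ∑ j, C (M i j) * p j

end Transformations

/-! ### The resultant and its content -/

section Resultant

variable {K : Type*} [Field K]

variable (K) in
/-- The ring `K[t_1, t_2][x_1, …, x_4]`. -/
abbrev CoeffRing : Type _ := MvPolynomial (Fin 4) (MvPolynomial (Fin 2) K)

/-- A polynomial in `t_1, t_2, t_3`, read as a polynomial in `t_3` over `K[t_1, t_2][x]`. -/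
def asPolyInT₃ : MvPolynomial (Fin 3) K →ₐ[K] Polynomial (CoeffRing K) :=
  aeval ![Polynomial.C (C (X 0)), Polynomial.C (C (X 1)), Polynomial.X]

variable (K) in
/-- The indeterminate `x_i`, as a constant polynomial in `t_3`. -/
def xVar (i : Fin 4) : Polynomial (CoeffRing K) := Polynomial.C (X i)

/-- `K_1^L = x_4 L_1(P) - x_1 L_4(P)`. -/
def K₁ (M : GL (Fin 4) K) (p : Fin 4 → MvPolynomial (Fin 3) K) : Polynomial (CoeffRing K) :=
  xVar K 3 * asPolyInT₃ (transformed M p 0) - xVar K 0 * asPolyInT₃ (transformed M p 3)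

/-- `K_2^L = x_4 L_3(P) - x_3 L_4(P)`. -/
def K₂ (M : GL (Fin 4) K) (p : Fin 4 → MvPolynomial (Fin 3) K) : Polynomial (CoeffRing K) :=
  xVar K 3 * asPolyInT₃ (transformed M p 2) - xVar K 2 * asPolyInT₃ (transformed M p 3)

/-- `Res_{t_3}(K_1^L, K_2^L)`. -/
def resK (M : GL (Fin 4) K) (p : Fin 4 → MvPolynomial (Fin 3) K) : CoeffRing K :=
  Polynomial.resultant (K₁ M p) (K₂ M p)

/-- The content with respect to `x`: a greatest common divisor in `K[t_1, t_2]` of the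
coefficients of a polynomial in `x_1, …, x_4`. -/
def contentX (f : CoeffRing K) : MvPolynomial (Fin 2) K :=
  letI := UniqueFactorizationMonoid.strongNormalizationMonoid (α := MvPolynomial (Fin 2) K)
  letI := UniqueFactorizationMonoid.toNormalizedGCDMonoid (MvPolynomial (Fin 2) K)
  f.support.gcd f.coeff

/-- The universal property of the content, which determines it up to a unit. -/
theorem dvd_contentX_iff (f : CoeffRing K) (q : MvPolynomial (Fin 2) K) :
    q ∣ contentX f ↔ ∀ m, q ∣ f.coeff m := by
  let := UniqueFactorizationMonoid.strongNormalizationMonoid (α := MvPolynomial (Fin 2) K)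
  let := UniqueFactorizationMonoid.toNormalizedGCDMonoid (MvPolynomial (Fin 2) K)
  refine Finset.dvd_gcd_iff.trans ⟨fun h m => ?_, fun h m _ => h m⟩
  by_cases hm : m ∈ f.support
  · exact h m hm
  · rw [MvPolynomial.notMem_support_iff.mp hm]
    exact dvd_zero q

end Resultant

end BaseLocus

end

/-! Both numbers count the linear factors over `K` of one binary form. Let `genericRes` be the
resultant in t_3 of ∑ x_i p_i and ∑ y_i p_i, a form of degree d² in t_1, t_2 over K[x, y]. Splitting
off every linear factor with coefficients in `K` gives `genericRes` = P · R, where P is a product of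
linear forms indexed by a multiset `ms` of points of ℙ¹(K), and R(o) is a nonzero polynomial in x, y
for every o ∈ ℙ¹(K) (`exists_lineForm_factorization`). Each side of the formula equals `card ms`.

Base points. At o ∈ ℙ¹(K), the resultant of W_1 and W_2 vanishes to an order equal to the sum of the
intersection multiplicities of the two curves at the points over o
(`rootMultiplicity_resultant_eq_sum`). To see this, truncate by a high power of the local parameter:
the quotient by the two curves becomes the cokernel of the Sylvester map, whose dimension is
computed by Smith normal form (`finrank_coker_sup`), and it is also the sum of its localizations
(`finrank_quotient_eq_sum`). Algebraic independence of x, y forces every common zero over o to be a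
base point (`common_zero_of_algebraicIndependent`). Summing over o yields
`baseLocusMultiplicity_eq_card`.

Content. For L in G*, the polynomials K_1^L and K_2^L are members of the linear system with
coefficients linear in x and have exact t_3-degree d, so their resultant is P · R_L with R_L a
specialization of R. A further nonconstant common factor of the coefficients would divide a nonzero
binary form over `K`, hence vanish at some o ∈ ℙ¹(K). So the content is P up to a unit as soon as,
for every o, some value ξ of x makes R_L(ξ) nonzero at o (`resK_ne_zero_and_totalDegree_contentX`).

This condition contains a nonempty open one. If it holds for one matrix, two values of x already
give forms without common zero, and their resultant is a polynomial in the matrix entries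
(`exists_hypersurface`). A suitable matrix exists (`exists_general_matrix`): over the finitely many
o in `ms` a general pair of members is reached, and over any other o there is no base point, so two
members can be chosen without common zero there. -/

noncomputable section

namespace BaseLocus

/-! ### Resultants of ternary forms -/

section FormRes

open MvPolynomial

variable {S S' : Type*} [CommRing S] [CommRing S']

/-- A ternary polynomial, read as a polynomial in the last variable. -/
def asPoly : MvPolynomial (Fin 3) S →ₐ[S] Polynomial (MvPolynomial (Fin 2) S) :=
  aeval ![Polynomial.C (X 0), Polynomial.C (X 1), Polynomial.X]

theorem asPoly_monomial (m : Fin 3 →₀ ℕ) (c : S) :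
    asPoly (monomial m c) =
      Polynomial.monomial (m 2) (C c * X 0 ^ m 0 * X 1 ^ m 1 : MvPolynomial (Fin 2) S) := by
  rw [asPoly, aeval_monomial, Finsupp.prod_fintype _ _ (by simp), Fin.prod_univ_three,
    ← Polynomial.C_mul_X_pow_eq_monomial]
  simp [MvPolynomial.algebraMap_eq, mul_assoc]

theorem coeff_asPoly (f : MvPolynomial (Fin 3) S) (i : ℕ) :
    (asPoly f).coeff i = ∑ m ∈ f.support,
      if m 2 = i then (C (f.coeff m) * X 0 ^ m 0 * X 1 ^ m 1 : MvPolynomial (Fin 2) S) else 0 := by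
  conv_lhs => rw [f.as_sum, map_sum, Polynomial.finsetSum_coeff]
  simp only [asPoly_monomial, Polynomial.coeff_monomial]

theorem degree_eq_of_mem_support {f : MvPolynomial (Fin 3) S} {d : ℕ} (hf : f.IsHomogeneous d)
    {m : Fin 3 →₀ ℕ} (hm : m ∈ f.support) : m 0 + m 1 + m 2 = d := by
  have := hf (mem_support_iff.mp hm)
  rw [Finsupp.weight_apply, Finsupp.sum_fintype _ _ (by simp)] at this
  simpa [Fin.sum_univ_three] using this

theorem coeff_asPoly_eq_zero {f : MvPolynomial (Fin 3) S} {d i : ℕ} (hf : f.IsHomogeneous d)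
    (hi : d < i) : (asPoly f).coeff i = 0 := by
  rw [coeff_asPoly]
  refine Finset.sum_eq_zero fun m hm => if_neg ?_
  have := degree_eq_of_mem_support hf hm
  omega

theorem natDegree_asPoly_le {f : MvPolynomial (Fin 3) S} {d : ℕ} (hf : f.IsHomogeneous d) :
    (asPoly f).natDegree ≤ d :=
  Polynomial.natDegree_le_iff_coeff_eq_zero.mpr fun _ hi => coeff_asPoly_eq_zero hf hi

theorem isHomogeneous_coeff_asPoly {f : MvPolynomial (Fin 3) S} {d i : ℕ}
    (hf : f.IsHomogeneous d) : ((asPoly f).coeff i).IsHomogeneous (d - i) := by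
  rw [coeff_asPoly]
  refine IsHomogeneous.sum _ _ _ fun m hm => ?_
  split_ifs with h
  · have := degree_eq_of_mem_support hf hm
    have h2 := ((isHomogeneous_C (Fin 2) (f.coeff m)).mul
      ((isHomogeneous_X S (0 : Fin 2)).pow (m 0))).mul ((isHomogeneous_X S (1 : Fin 2)).pow (m 1))
    convert h2 using 1
    omega
  · exact isHomogeneous_zero _ _ _

theorem coeff_asPoly_self {f : MvPolynomial (Fin 3) S} {d : ℕ} (hf : f.IsHomogeneous d) :
    (asPoly f).coeff d = C (eval ![0, 0, 1] f) := by
  rw [coeff_asPoly, eval_eq', map_sum]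
  refine Finset.sum_congr rfl fun m hm => ?_
  have := degree_eq_of_mem_support hf hm
  rw [Fin.prod_univ_three]
  split_ifs with h
  · have h0 : m 0 = 0 := by omega
    have h1 : m 1 = 0 := by omega
    simp [h0, h1]
  · have : m 0 ≠ 0 ∨ m 1 ≠ 0 := by omega
    rcases this with h | h <;> simp [h]

theorem asPoly_map (φ : S →+* S') (f : MvPolynomial (Fin 3) S) :
    asPoly (map φ f) = (asPoly f).map (map φ) := by
  induction f using MvPolynomial.induction_on with
  | C a => simp [asPoly, MvPolynomial.algebraMap_eq]
  | add p q hp hq => simp [hp, hq]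
  | mul_X p i hp =>
    rw [map_mul, map_mul, hp, map_X, map_mul, Polynomial.map_mul]
    congr 1
    fin_cases i <;> simp [asPoly]

/-- The resultant of two ternary forms of degree `d` with respect to the last variable. -/
def formRes (d : ℕ) (f g : MvPolynomial (Fin 3) S) : MvPolynomial (Fin 2) S :=
  Polynomial.resultant (asPoly f) (asPoly g) d d

theorem formRes_map (d : ℕ) (φ : S →+* S') (f g : MvPolynomial (Fin 3) S) :
    formRes d (map φ f) (map φ g) = map φ (formRes d f g) := by
  rw [formRes, asPoly_map, asPoly_map, Polynomial.resultant_map_map, formRes]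

/-- In either block, the entry in row i and shift j is the coefficient of t_3^(i-j), of degree d -
(i - j): a column weight d + j minus a row weight i, the shape needed for `isHomogeneous_det`. -/
theorem isHomogeneous_sylvester {f g : MvPolynomial (Fin 3) S} {d : ℕ} (hf : f.IsHomogeneous d)
    (hg : g.IsHomogeneous d) (i j : Fin (d + d)) :
    Polynomial.sylvester (asPoly f) (asPoly g) d d i j = 0 ∨
    ∃ e : ℕ, e + (i : ℕ) = d + j.addCases (fun a : Fin d => (a : ℕ)) (fun a : Fin d => (a : ℕ)) ∧
      (Polynomial.sylvester (asPoly f) (asPoly g) d d i j).IsHomogeneous e := by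
  induction j using Fin.addCases with
  | left j =>
    simp only [Polynomial.sylvester, Matrix.of_apply, Fin.addCases_left]
    split_ifs with h
    · refine Or.inr ⟨d - (i - j), ?_, isHomogeneous_coeff_asPoly hg⟩
      have := h.1; have := h.2
      omega
    · exact Or.inl rfl
  | right j =>
    simp only [Polynomial.sylvester, Matrix.of_apply, Fin.addCases_right]
    split_ifs with h
    · refine Or.inr ⟨d - (i - j), ?_, isHomogeneous_coeff_asPoly hf⟩
      have := h.1; have := h.2
      omega
    · exact Or.inl rfl

/-- A permutation only reorders the row weights, so every nonzero Leibniz term has degree ∑ b - ∑ a.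
-/
theorem isHomogeneous_det {ι σ : Type*} [Fintype ι] [DecidableEq ι]
    (M : Matrix ι ι (MvPolynomial σ S)) (a b : ι → ℕ) (N : ℕ)
    (hM : ∀ i j, M i j = 0 ∨ ∃ e : ℕ, e + a i = b j ∧ (M i j).IsHomogeneous e)
    (hN : N + ∑ i, a i = ∑ j, b j) : M.det.IsHomogeneous N := by
  rw [Matrix.det_apply]
  refine IsHomogeneous.sum _ _ _ fun τ _ => ?_
  suffices h : (∏ j, M (τ j) j).IsHomogeneous N by
    rcases Int.units_eq_one_or (Equiv.Perm.sign τ) with hs | hs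
    · simpa [hs] using h
    · simpa [hs] using h.neg
  by_cases h0 : ∃ j, M (τ j) j = 0
  · obtain ⟨j, hj⟩ := h0
    have h : ∏ j, M (τ j) j = 0 := Finset.prod_eq_zero (Finset.mem_univ j) hj
    simpa only [h] using isHomogeneous_zero σ S N
  push Not at h0
  choose e he using fun j => (hM (τ j) j).resolve_left (h0 j)
  have key : ∑ j, e j = N := by
    have h1 : ∑ j, (e j + a (τ j)) = ∑ j, b j := Finset.sum_congr rfl fun j _ => (he j).1
    rw [Finset.sum_add_distrib, Equiv.sum_comp τ a] at h1
    omega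
  rw [← key]
  exact IsHomogeneous.prod _ _ _ fun j _ => (he j).2

theorem isHomogeneous_formRes {f g : MvPolynomial (Fin 3) S} {d : ℕ} (hf : f.IsHomogeneous d)
    (hg : g.IsHomogeneous d) : (formRes d f g).IsHomogeneous (d * d) := by
  refine isHomogeneous_det _ _ _ _ (isHomogeneous_sylvester hf hg) ?_
  rw [Finset.sum_add_distrib, Fin.sum_univ_add (fun i : Fin (d + d) => (i : ℕ)),
    Fin.sum_univ_add (fun j : Fin (d + d) =>
      (j.addCases (fun a : Fin d => (a : ℕ)) (fun a : Fin d => (a : ℕ)) : ℕ))]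
  simp only [Fin.val_castAdd, Fin.val_natAdd, Fin.addCases_left, Fin.addCases_right,
    Finset.sum_add_distrib, Finset.sum_const, Finset.card_univ, Fintype.card_fin, smul_eq_mul]
  ring

end FormRes

/-! ### Binary forms -/

section BinaryForms

open MvPolynomial

theorem aeval_mul_of_isHomogeneous {σ S A : Type*} [CommSemiring S] [CommSemiring A] [Algebra S A]
    {f : MvPolynomial σ S} {N : ℕ} (hf : f.IsHomogeneous N) (c : A) (v : σ → A) :
    aeval (fun i => c * v i) f = c ^ N * aeval v f := by
  rw [aeval_def, aeval_def, eval₂_eq, eval₂_eq, Finset.mul_sum]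
  refine Finset.sum_congr rfl fun m hm => ?_
  have h := hf.degree_eq_sum_deg_support hm
  simp only [mul_pow, Finset.prod_mul_distrib, Finset.prod_pow_eq_pow_sum]
  rw [h]
  ring

/-- Over a ring with zero divisors a cofactor need not be homogeneous, but its component of degree N
is again a cofactor. -/
theorem exists_isHomogeneous_quotient {σ S : Type*} [CommRing S]
    {f l : MvPolynomial σ S} {N : ℕ} (hf : f.IsHomogeneous (N + 1)) (hl : l.IsHomogeneous 1)
    (h : l ∣ f) : ∃ q : MvPolynomial σ S, q.IsHomogeneous N ∧ f = l * q := by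
  obtain ⟨q, rfl⟩ := h
  refine ⟨homogeneousComponent N q, homogeneousComponent_isHomogeneous _ _, ?_⟩
  conv_lhs => rw [← homogeneousComponent_eq_self hf]
  conv_lhs => rw [← sum_homogeneousComponent q, Finset.mul_sum, map_sum]
  have h1 : ∀ i, homogeneousComponent (N + 1) (l * homogeneousComponent i q) =
      if i = N then l * homogeneousComponent i q else 0 := by
    intro i
    rw [homogeneousComponent_of_mem (n := 1 + i) (hl.mul (homogeneousComponent_isHomogeneous _ _))]
    exact if_congr (by omega) rfl rfl
  simp only [h1]
  rw [Finset.sum_ite_eq']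
  split_ifs with h2
  · rfl
  · rw [homogeneousComponent_eq_zero, mul_zero]
    simpa using h2

/-- A binary form, in the affine chart of the projective line that contains a given point. -/
def lineChart {K : Type*} (S : Type*) [CommRing S] (o : Option K) :
    MvPolynomial (Fin 2) S →ₐ[S] Polynomial S :=
  aeval (o.elim ![Polynomial.X, 1] fun _ => ![1, Polynomial.X])

theorem lineChart_map {K S S' : Type*} [CommRing S] [CommRing S'] (φ : S →+* S') (o : Option K)
    (f : MvPolynomial (Fin 2) S) :
    lineChart S' o (map φ f) = (lineChart S o f).map φ := by
  have : (lineChart S' o : MvPolynomial (Fin 2) S' →+* Polynomial S').comp (map φ) =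
      (Polynomial.mapRingHom φ).comp (lineChart S o : MvPolynomial (Fin 2) S →+* _) := by
    ext i
    · simp [lineChart]
    · cases o <;> fin_cases i <;> simp [lineChart]
  exact DFunLike.congr_fun this f

theorem natDegree_lineChart_le {K S : Type*} [CommRing S] {f : MvPolynomial (Fin 2) S} {N : ℕ}
    (hf : f.IsHomogeneous N) (τ : K) : (lineChart S (some τ) f).natDegree ≤ N := by
  rw [lineChart, aeval_def, eval₂_eq']
  refine Polynomial.natDegree_sum_le_of_forall_le _ _ fun m hm => ?_
  have h := hf.degree_eq_sum_deg_support hm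
  rw [← Finsupp.degree_apply, Finsupp.degree_eq_sum, Fin.sum_univ_two] at h
  simp only [Fin.prod_univ_two]
  refine (Polynomial.natDegree_C_mul_le _ _).trans ?_
  simpa using (Polynomial.natDegree_X_pow_le (m 1)).trans (by omega)

variable {K : Type*} [Field K]

/-- The points of the projective line over `K`: the point `(1 : τ)` for `some τ`, and `(0 : 1)` for
`none`. -/
def lineRep (o : Option K) : Fin 2 → K := o.elim ![0, 1] fun τ => ![1, τ]

/-- A linear form that vanishes exactly at a given point of the projective line. -/
def lineForm (o : Option K) : MvPolynomial (Fin 2) K := o.elim (X 0) fun τ => X 1 - C τ * X 0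

theorem isHomogeneous_lineForm (o : Option K) : (lineForm o).IsHomogeneous 1 := by
  cases o with
  | none => exact isHomogeneous_X K 0
  | some τ => exact (isHomogeneous_X K 1).sub ((isHomogeneous_X K 0).C_mul τ)

theorem eval_lineForm_self (o : Option K) : eval (lineRep o) (lineForm o) = 0 := by
  cases o <;> simp [lineRep, lineForm]

theorem irreducible_lineForm (o : Option K) : Irreducible (lineForm o) := by
  refine irreducible_of_totalDegree_eq_one ?_ ?_
  · refine (isHomogeneous_lineForm o).totalDegree ?_
    intro h
    cases o with
    | none => exact X_ne_zero 0 h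
    | some τ =>
      have := congrArg (eval ![0, 1]) h
      simp [lineForm] at this
  · intro x hx
    cases o with
    | none => exact isUnit_of_dvd_one (by simpa [lineForm] using hx (Finsupp.single 0 1))
    | some τ =>
      refine isUnit_of_dvd_one ?_
      have := hx (Finsupp.single 1 1)
      simpa [lineForm, coeff_C_mul, coeff_X, Finsupp.single_left_inj] using this

variable {S : Type*} [CommRing S] [Algebra K S]

/-- The value of a binary form at a point of the projective line over a subfield. -/
def lineEval (S : Type*) [CommRing S] [Algebra K S] (o : Option K) : MvPolynomial (Fin 2) S →+* S :=
  eval fun i => algebraMap K S (lineRep o i)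

theorem lineEval_map {S' : Type*} [CommRing S'] [Algebra K S'] (φ : S →ₐ[K] S') (o : Option K)
    (f : MvPolynomial (Fin 2) S) :
    lineEval S' o (map φ.toRingHom f) = φ (lineEval S o f) := by
  rw [lineEval, lineEval, eval_map, ← AlgHom.coe_toRingHom, eval, coe_eval₂Hom, hom_eval₂]
  simp

/-- Modulo the linear form, the vector of variables is `L` times the coordinates of the point, with
`L` the variable that is 1 there. Homogeneity then gives f ≡ L^N f(o) = 0. -/
theorem map_lineForm_dvd {f : MvPolynomial (Fin 2) S} {N : ℕ} (hf : f.IsHomogeneous N)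
    {o : Option K} (h : lineEval S o f = 0) : map (algebraMap K S) (lineForm o) ∣ f := by
  rw [← Ideal.mem_span_singleton, ← Ideal.Quotient.eq_zero_iff_mem]
  set I := Ideal.span {map (algebraMap K S) (lineForm o)} with hI
  let L : MvPolynomial (Fin 2) S := o.elim (X 1) fun _ => X 0
  have hX : ∀ i : Fin 2, Ideal.Quotient.mk I (X i) =
      Ideal.Quotient.mk I L * algebraMap S _ (algebraMap K S (lineRep o i)) := by
    intro i
    have h1 : (algebraMap S (MvPolynomial (Fin 2) S ⧸ I)) (algebraMap K S (lineRep o i)) =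
      Ideal.Quotient.mk I (C (algebraMap K S (lineRep o i))) := rfl
    rw [h1, ← map_mul, Ideal.Quotient.eq, hI, Ideal.mem_span_singleton]
    cases o with
    | none => fin_cases i <;> simp [L, lineRep, lineForm]
    | some τ => fin_cases i <;> simp [L, lineRep, lineForm, mul_comm]
  have h2 : Ideal.Quotient.mk I f = aeval (fun i => Ideal.Quotient.mk I (X i)) f := by
    have : Ideal.Quotient.mkₐ S I = aeval (fun i => Ideal.Quotient.mk I (X i)) := by
      ext i; simp
    exact DFunLike.congr_fun this f
  rw [h2]
  simp only [hX]
  rw [aeval_mul_of_isHomogeneous hf]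
  have h3 : aeval (fun i => algebraMap S (MvPolynomial (Fin 2) S ⧸ I)
      (algebraMap K S (lineRep o i))) f = algebraMap S _ (lineEval S o f) := by
    exact aeval_algebraMap_apply (B := MvPolynomial (Fin 2) S ⧸ I) _ _
  rw [h3, h, map_zero, mul_zero]

/-- Induction on the degree, removing one linear form for each zero. Only points over `K` are
tested, so the cofactor may still have zeros over an extension. -/
theorem exists_lineForm_factorization {N : ℕ} {f : MvPolynomial (Fin 2) S}
    (hf : f.IsHomogeneous N) (h0 : f ≠ 0) :
    ∃ (ms : Multiset (Option K)) (n : ℕ) (g : MvPolynomial (Fin 2) S), g.IsHomogeneous n ∧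
      f = map (algebraMap K S) (ms.map lineForm).prod * g ∧ ∀ o : Option K, lineEval S o g ≠ 0 := by
  induction N generalizing f with
  | zero =>
    refine ⟨0, 0, f, hf, by simp, fun o h => h0 ?_⟩
    rw [totalDegree_eq_zero_iff_eq_C.mp ((totalDegree_zero_iff_isHomogeneous _).mpr hf)] at h ⊢
    simpa [lineEval] using h
  | succ N ih =>
    by_cases h : ∀ o : Option K, lineEval S o f ≠ 0
    · exact ⟨0, N + 1, f, hf, by simp, h⟩
    push Not at h
    obtain ⟨o, ho⟩ := h
    obtain ⟨q, hq, rfl⟩ := exists_isHomogeneous_quotient hf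
      ((isHomogeneous_lineForm o).map (algebraMap K S)) (map_lineForm_dvd hf ho)
    obtain ⟨ms, n, g, hg, rfl, hne⟩ := ih hq (right_ne_zero_of_mul h0)
    exact ⟨o ::ₘ ms, n, g, hg, by simp [mul_assoc], hne⟩

/-- The coordinate of a point of the projective line in its affine chart. -/
def lineCoord (o : Option K) : K := o.elim 0 id

theorem eval_lineChart (o : Option K) (f : MvPolynomial (Fin 2) S) :
    (lineChart S o f).eval (algebraMap K S (lineCoord o)) = lineEval S o f := by
  have : (Polynomial.evalRingHom (algebraMap K S (lineCoord o))).comp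
      (lineChart S o : MvPolynomial (Fin 2) S →+* Polynomial S) = lineEval S o := by
    ext i
    · simp [lineChart, lineEval]
    · cases o <;> fin_cases i <;> simp [lineChart, lineEval, lineRep, lineCoord]
  exact DFunLike.congr_fun this f

/-- The point (0 : 1) is at infinity in this chart, so nonvanishing there means that the degree in
the chart does not drop. -/
theorem coeff_lineChart {f : MvPolynomial (Fin 2) S} {N : ℕ} (hf : f.IsHomogeneous N) (τ : K) :
    (lineChart S (some τ) f).coeff N = lineEval S (none : Option K) f := by
  rw [lineChart, aeval_def, eval₂_eq', lineEval, eval_eq', Polynomial.finsetSum_coeff]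
  refine Finset.sum_congr rfl fun m hm => ?_
  have h := hf.degree_eq_sum_deg_support hm
  rw [← Finsupp.degree_apply, Finsupp.degree_eq_sum, Fin.sum_univ_two] at h
  rw [← Polynomial.C_eq_algebraMap, Polynomial.coeff_C_mul]
  simp only [Fin.prod_univ_two]
  by_cases h0 : m 0 = 0
  · have : m 1 = N := by omega
    simp [h0, this, lineRep]
  · have : N ≠ m 1 := by omega
    simp [h0, this, lineRep, Polynomial.coeff_X_pow]

theorem rootMultiplicity_lineChart_lineForm [IsDomain S] [DecidableEq K] (o o' : Option K) :
    (lineChart S o (map (algebraMap K S) (lineForm o'))).rootMultiplicity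
      (algebraMap K S (lineCoord o)) = if o' = o then 1 else 0 := by
  have hinj : Function.Injective (algebraMap K S) := FaithfulSMul.algebraMap_injective K S
  cases o with
  | none =>
    cases o' with
    | none =>
      simp only [lineChart, lineForm, lineCoord, Option.elim_none, map_X, aeval_X, map_zero]
      have := Polynomial.rootMultiplicity_X_sub_C_self (x := (0 : S))
      simpa using this
    | some τ' =>
      rw [if_neg (by simp)]
      refine Polynomial.rootMultiplicity_eq_zero ?_
      simp [lineChart, lineForm, lineCoord]
  | some τ =>
    cases o' with
    | none =>
      rw [if_neg (by simp)]
      refine Polynomial.rootMultiplicity_eq_zero ?_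
      simp [lineChart, lineForm, lineCoord]
    | some τ' =>
      have h1 : lineChart S (some τ) (map (algebraMap K S) (lineForm (some τ'))) =
          Polynomial.X - Polynomial.C (algebraMap K S τ') := by
        simp [lineChart, lineForm]
      classical
      rw [h1, Polynomial.rootMultiplicity_X_sub_C]
      simp [lineCoord, hinj.eq_iff, eq_comm]

theorem lineChart_lineForm_ne_zero [IsDomain S] (o o' : Option K) :
    lineChart S o (map (algebraMap K S) (lineForm o')) ≠ 0 := fun h => by
  cases o <;> cases o' <;> simp [lineChart, lineForm] at h
  · have := congrArg (Polynomial.eval 0) h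
    simp at this
  · exact Polynomial.X_sub_C_ne_zero _ h

theorem lineChart_prod_mul_ne_zero [IsDomain S] (o : Option K) (ms : Multiset (Option K))
    {g : MvPolynomial (Fin 2) S} (hg : lineEval S o g ≠ 0) :
    lineChart S o (map (algebraMap K S) (ms.map lineForm).prod * g) ≠ 0 := by
  rw [map_mul, map_multiset_prod, map_multiset_prod]
  refine mul_ne_zero (Multiset.prod_ne_zero fun h => ?_) fun h => hg ?_
  · simp only [Multiset.map_map, Multiset.mem_map, Function.comp_apply] at h
    obtain ⟨a, -, ha⟩ := h
    exact lineChart_lineForm_ne_zero o a ha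
  · rw [← eval_lineChart, h, Polynomial.eval_zero]

theorem rootMultiplicity_lineChart_prod [IsDomain S] [DecidableEq K] (o : Option K)
    (ms : Multiset (Option K)) {g : MvPolynomial (Fin 2) S} (hg : lineEval S o g ≠ 0) :
    (lineChart S o (map (algebraMap K S) (ms.map lineForm).prod * g)).rootMultiplicity
      (algebraMap K S (lineCoord o)) = ms.count o := by
  have hg0 : ¬ (lineChart S o g).IsRoot (algebraMap K S (lineCoord o)) := by
    rwa [Polynomial.IsRoot, eval_lineChart]
  induction ms using Multiset.induction_on with
  | empty => simpa using Polynomial.rootMultiplicity_eq_zero hg0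
  | cons o' ms ih =>
    rw [Multiset.map_cons, Multiset.prod_cons, map_mul (map _), mul_assoc, map_mul (lineChart S o),
      Polynomial.rootMultiplicity_mul, ih, rootMultiplicity_lineChart_lineForm,
      Multiset.count_cons, add_comm]
    · simp only [eq_comm]
    · exact mul_ne_zero (lineChart_lineForm_ne_zero o o') (lineChart_prod_mul_ne_zero o ms hg)

theorem isHomogeneous_zero_of_lineEval_ne_zero [IsAlgClosed K] {g : MvPolynomial (Fin 2) K} {n : ℕ}
    (hg : g.IsHomogeneous n) (h : ∀ o : Option K, lineEval K o g ≠ 0) : n = 0 := by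
  have h1 : (lineChart K (some (0 : K)) g).natDegree = n :=
    le_antisymm (natDegree_lineChart_le hg 0)
      (Polynomial.le_natDegree_of_ne_zero (by rw [coeff_lineChart hg]; exact h none))
  by_contra hn
  obtain ⟨x, hx⟩ := IsAlgClosed.exists_root (lineChart K (some (0 : K)) g)
    (fun h2 => hn (by rw [← h1, Polynomial.natDegree_eq_of_degree_eq_some h2]; rfl))
  exact h (some x) (by rw [← eval_lineChart]; exact hx)

/-- Over an algebraically closed field the form is a unit times a product of linear forms, so an
irreducible factor of `D` is associated to one of them. `D` itself need not be known to be
homogeneous. -/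
theorem exists_lineEval_eq_zero_of_dvd [IsAlgClosed K] {f D : MvPolynomial (Fin 2) K} {N : ℕ}
    (hf : f.IsHomogeneous N) (h0 : f ≠ 0) (hD : D ∣ f) (hu : ¬ IsUnit D) :
    ∃ o : Option K, lineEval K o D = 0 := by
  obtain ⟨q, hq, hqD⟩ := WfDvdMonoid.exists_irreducible_factor hu (ne_zero_of_dvd_ne_zero h0 hD)
  obtain ⟨ms, n, g, hg, rfl, hne⟩ := exists_lineForm_factorization (K := K) hf h0
  obtain rfl := isHomogeneous_zero_of_lineEval_ne_zero hg hne
  have hgu : IsUnit g := by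
    have h1 := totalDegree_eq_zero_iff_eq_C.mp ((totalDegree_zero_iff_isHomogeneous _).mpr hg)
    rw [h1]
    refine IsUnit.map C (Ne.isUnit fun h2 => hne none ?_)
    rw [h1, h2, map_zero, map_zero]
  have h1 : q ∣ (ms.map lineForm).prod := by
    have := hqD.trans hD
    rwa [hgu.dvd_mul_right, Algebra.algebraMap_self, map_id] at this
  obtain ⟨o, -, ho⟩ := hq.prime.exists_mem_multiset_map_dvd h1
  obtain ⟨r, rfl⟩ := ((hq.associated_of_dvd (irreducible_lineForm o) ho).dvd').trans hqD
  refine ⟨o, ?_⟩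
  rw [map_mul, show lineEval K o (lineForm o) = 0 from eval_lineForm_self o, zero_mul]

end BinaryForms

/-! ### The cokernel of a square matrix over `k[T]`, locally at a point -/

section Cokernel

open Polynomial Module
open scoped Pointwise

variable {k : Type*} [Field k]

theorem span_pair_pow_eq (τ : k) {a : k[X]} (ha : a ≠ 0) {N : ℕ}
    (hN : a.rootMultiplicity τ ≤ N) :
    Ideal.span {a, (X - C τ) ^ N} = Ideal.span {(X - C τ) ^ a.rootMultiplicity τ} := by
  obtain ⟨u, hu, hdvd⟩ := exists_eq_pow_rootMultiplicity_mul_and_not_dvd a ha τ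
  set e := a.rootMultiplicity τ
  have hcop : IsCoprime u ((X - C τ) ^ (N - e)) :=
    (((irreducible_X_sub_C τ).coprime_iff_not_dvd.mpr hdvd).pow_left).symm
  rw [hu, ← Nat.add_sub_cancel' hN, pow_add]
  apply le_antisymm
  · rw [Ideal.span_le, Set.insert_subset_iff, Set.singleton_subset_iff]
    exact ⟨Ideal.mem_span_singleton.mpr (dvd_mul_right _ _),
      Ideal.mem_span_singleton.mpr (dvd_mul_right _ _)⟩
  · obtain ⟨α, β, h⟩ := hcop
    rw [Ideal.span_singleton_le_iff_mem, Ideal.mem_span_pair]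
    exact ⟨α, β, by linear_combination (X - C τ) ^ e * h⟩

theorem rootMultiplicity_prod_of_ne_zero {ι : Type*} (τ : k) (s : Finset ι) (a : ι → k[X])
    (ha : ∀ i, a i ≠ 0) :
    (∏ i ∈ s, a i).rootMultiplicity τ = ∑ i ∈ s, (a i).rootMultiplicity τ := by
  classical
  induction s using Finset.induction_on with
  | empty => simp
  | insert i s hi ih =>
    rw [Finset.prod_insert hi, Finset.sum_insert hi, rootMultiplicity_mul, ih]
    exact mul_ne_zero (ha i) (Finset.prod_ne_zero_iff.mpr fun j _ => ha j)

theorem rootMultiplicity_eq_of_associated (τ : k) {a b : k[X]} (h : Associated a b) (hb : b ≠ 0) :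
    a.rootMultiplicity τ = b.rootMultiplicity τ := by
  have ha : a ≠ 0 := h.ne_zero_iff.mpr hb
  apply le_antisymm
  · exact rootMultiplicity_le_rootMultiplicity_of_dvd hb h.dvd τ
  · exact rootMultiplicity_le_rootMultiplicity_of_dvd ha h.dvd' τ

variable {ι : Type*} [Fintype ι]

/-- Factor φ as an isomorphism onto its range followed by the inclusion. In Smith bases the
inclusion is diagonal; the other matrices are invertible. -/
theorem associated_det_prod {V₁ V₂ : Type*} [AddCommGroup V₁] [AddCommGroup V₂] [Module k[X] V₁]
    [Module k[X] V₂] [DecidableEq ι] (b₁ : Basis ι k[X] V₁) (b₂ b' : Basis ι k[X] V₂)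
    (φ : V₁ →ₗ[k[X]] V₂) (hφ : Function.Injective φ) (a : ι → k[X])
    (ab : Basis ι k[X] (LinearMap.range φ)) (h : ∀ i, (ab i : V₂) = a i • b' i) :
    Associated (LinearMap.toMatrix b₁ b₂ φ).det (∏ i, a i) := by
  let e := LinearEquiv.ofInjective φ hφ
  have h1 : LinearMap.toMatrix b₁ b₂ φ = LinearMap.toMatrix b' b₂ LinearMap.id *
      (Matrix.diagonal a * LinearMap.toMatrix b₁ ab (e : V₁ →ₗ[k[X]] LinearMap.range φ)) := by
    have h2 : LinearMap.toMatrix ab b' (LinearMap.range φ).subtype = Matrix.diagonal a := by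
      ext i j
      rw [LinearMap.toMatrix_apply, Submodule.subtype_apply, h, map_smul, Basis.repr_self,
        Matrix.diagonal_apply]
      simp only [Finsupp.smul_apply, Finsupp.single_apply, smul_eq_mul]
      split_ifs with h3 h4 h4
      · simp [h3]
      · exact absurd h3.symm h4
      · exact absurd h4.symm h3
      · simp
    rw [← h2, ← LinearMap.toMatrix_comp, ← LinearMap.toMatrix_comp]
    rfl
  rw [h1, Matrix.det_mul, Matrix.det_mul, Matrix.det_diagonal]
  have u1 : IsUnit (LinearMap.toMatrix b' b₂ LinearMap.id).det :=
    LinearEquiv.isUnit_det (LinearEquiv.refl k[X] V₂) b' b₂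
  have u2 : IsUnit (LinearMap.toMatrix b₁ ab (e : V₁ →ₗ[k[X]] LinearMap.range φ)).det :=
    LinearEquiv.isUnit_det e b₁ ab
  refine (associated_unit_mul_left _ _ u1).trans ?_
  exact associated_mul_unit_left _ _ u2

/-- In a Smith basis the quotient is the product of the k[X]/(a_i, (X - τ)^N). For N at least the
order of `a_i` at τ, that factor is k[X] modulo (X - τ) to this order, and the orders add up to the
order of the determinant. -/
theorem finrank_coker_sup {V₁ V₂ : Type*} [AddCommGroup V₁] [AddCommGroup V₂] [Module k[X] V₁]
    [Module k[X] V₂] [Module k V₂] [IsScalarTower k k[X] V₂] [DecidableEq ι]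
    (b₁ : Basis ι k[X] V₁) (b₂ : Basis ι k[X] V₂)
    (φ : V₁ →ₗ[k[X]] V₂) (hφ : (LinearMap.toMatrix b₁ b₂ φ).det ≠ 0) (τ : k) {N : ℕ}
    (hN : (LinearMap.toMatrix b₁ b₂ φ).det.rootMultiplicity τ ≤ N) :
    Module.Finite k (V₂ ⧸ (LinearMap.range φ ⊔ ((X - C τ) ^ N) • (⊤ : Submodule k[X] V₂))) ∧
    finrank k (V₂ ⧸ (LinearMap.range φ ⊔ ((X - C τ) ^ N) • (⊤ : Submodule k[X] V₂))) =
      (LinearMap.toMatrix b₁ b₂ φ).det.rootMultiplicity τ := by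
  have hinj : Function.Injective φ := by
    rw [injective_iff_map_eq_zero]
    intro x hx
    have h1 := LinearMap.toMatrix_mulVec_repr b₁ b₂ φ x
    rw [hx, map_zero, Finsupp.coe_zero] at h1
    have h2 := Matrix.eq_zero_of_mulVec_eq_zero hφ h1
    exact b₁.repr.map_eq_zero_iff.mp (DFunLike.coe_injective h2)
  have hrank : finrank k[X] (LinearMap.range φ) = finrank k[X] V₂ := by
    rw [LinearMap.finrank_range_of_inj hinj, finrank_eq_card_basis b₁, finrank_eq_card_basis b₂]
  obtain ⟨b', a, ab, h⟩ := Submodule.exists_smith_normal_form_of_rank_eq b₂ hrank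
  have hass := associated_det_prod b₁ b₂ b' φ hinj a ab h
  have hprod : ∏ i, a i ≠ 0 := hass.ne_zero_iff.mp hφ
  have ha : ∀ i, a i ≠ 0 := fun i => Finset.prod_ne_zero_iff.mp hprod i (Finset.mem_univ i)
  have hmult : (LinearMap.toMatrix b₁ b₂ φ).det.rootMultiplicity τ =
      ∑ i, (a i).rootMultiplicity τ := by
    rw [rootMultiplicity_eq_of_associated τ hass hprod, rootMultiplicity_prod_of_ne_zero τ _ a ha]
  have hle : ∀ i, (a i).rootMultiplicity τ ≤ N := fun i =>
    (Finset.single_le_sum (f := fun i => (a i).rootMultiplicity τ) (fun _ _ => Nat.zero_le _)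
      (Finset.mem_univ i)).trans (hmult ▸ hN)
  set c : ι → k[X] := fun i => (X - C τ) ^ (a i).rootMultiplicity τ with hc
  let N' : Submodule k[X] (ι → k[X]) := Submodule.pi Set.univ fun i => Ideal.span {c i}
  have hmap : Submodule.map (b'.equivFun : V₂ →ₗ[k[X]] ι → k[X])
      (LinearMap.range φ ⊔ ((X - C τ) ^ N) • (⊤ : Submodule k[X] V₂)) = N' := by
    apply le_antisymm
    · rw [Submodule.map_le_iff_le_comap, sup_le_iff]
      constructor
      · intro x hx
        rw [Submodule.mem_comap, Submodule.mem_pi]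
        intro i _
        have h1 : x = ∑ j, (ab.repr ⟨x, hx⟩ j * a j) • b' j := by
          have := congrArg (Submodule.subtype _) (ab.sum_repr ⟨x, hx⟩)
          rw [map_sum] at this
          simpa [h, mul_smul] using this.symm
        rw [h1, LinearEquiv.coe_coe, Basis.equivFun_apply, b'.repr_sum_self,
          Ideal.mem_span_singleton]
        exact ((pow_rootMultiplicity_dvd _ _)).mul_left _
      · intro x hx
        rw [Submodule.mem_comap, Submodule.mem_pi]
        intro i _
        obtain ⟨y, -, rfl⟩ := Submodule.mem_smul_pointwise_iff_exists _ _ _ |>.mp hx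
        rw [LinearEquiv.coe_coe, map_smul, Pi.smul_apply, smul_eq_mul, Ideal.mem_span_singleton]
        exact (pow_dvd_pow _ (hle i)).mul_right _
    · intro x hx
      rw [Submodule.mem_pi] at hx
      refine ⟨∑ i, x i • b' i, ?_, b'.equivFun_symm_apply x ▸ b'.equivFun.apply_symm_apply x⟩
      refine Submodule.sum_mem _ fun i _ => ?_
      have h1 : x i ∈ Ideal.span {a i, (X - C τ) ^ N} := by
        rw [span_pair_pow_eq τ (ha i) (hle i)]
        exact hx i trivial
      obtain ⟨α, β, h2⟩ := Ideal.mem_span_pair.mp h1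
      rw [← h2, add_smul, mul_smul, ← h, mul_comm β, mul_smul]
      refine Submodule.add_mem_sup (Submodule.smul_mem _ _ (ab i).2) ?_
      exact Submodule.smul_mem_pointwise_smul _ _ _ trivial
  let E := (Submodule.Quotient.equiv _ N' b'.equivFun hmap).trans
    (Submodule.quotientPi (fun i => (Ideal.span {c i} : Submodule k[X] k[X])))
  have hmonic : ∀ i, (c i).Monic := fun i => (monic_X_sub_C τ).pow _
  have hfin : ∀ i, Module.Finite k (k[X] ⧸ Ideal.span {c i}) := fun i =>
    (hmonic i).finite_quotient
  have E' := E.restrictScalars k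
  refine ⟨Module.Finite.equiv E'.symm, ?_⟩
  rw [E'.finrank_eq, finrank_pi_fintype, hmult]
  refine Finset.sum_congr rfl fun i _ => ?_
  rw [finrank_quotient_span_eq_natDegree, natDegree_pow, natDegree_X_sub_C, mul_one]

end Cokernel

/-! ### The quotient by two plane curves, locally over a point of the line -/

section Sylvester

open Polynomial Module
open scoped Pointwise

variable {k : Type*} [Field k]

/-- Identifies the Sylvester cokernel, truncated by `h`, with the quotient ring by `f`, `g`, `h`.
Since `f` is monic, the multipliers of `g` and `h` can be reduced modulo `f`; the multiplier of `f`
is then bounded by degrees. -/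
theorem mem_range_sylvesterMap_sup {f g : k[X][X]} {d : ℕ} (hf : f.Monic) (hfd : f.natDegree = d)
    (hgd : g.natDegree ≤ d) (h : k[X]) (x : degreeLT k[X] (d + d)) :
    x ∈ LinearMap.range (sylvesterMap f g hfd.le hgd) ⊔
        h • (⊤ : Submodule k[X] (degreeLT k[X] (d + d))) ↔
      (x : k[X][X]) ∈ Ideal.span {f, g, C h} := by
  have hf1 : f ∈ Ideal.span {f, g, C h} := Ideal.subset_span (by simp)
  have hg1 : g ∈ Ideal.span {f, g, C h} := Ideal.subset_span (by simp)
  have hh1 : C h ∈ Ideal.span {f, g, C h} := Ideal.subset_span (by simp)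
  constructor
  · intro hx
    obtain ⟨y, ⟨pq, rfl⟩, z, hz, rfl⟩ := Submodule.mem_sup.mp hx
    obtain ⟨w, -, rfl⟩ := (Submodule.mem_smul_pointwise_iff_exists _ _ _).mp hz
    rw [Submodule.coe_add, Submodule.coe_smul, sylvesterMap_apply_coe, smul_eq_C_mul]
    exact add_mem (add_mem (Ideal.mul_mem_right _ _ hf1) (Ideal.mul_mem_right _ _ hg1))
      (Ideal.mul_mem_right _ _ hh1)
  · intro hx
    obtain ⟨α, z, hz, hx⟩ := Ideal.mem_span_insert.mp hx
    obtain ⟨β, γ, rfl⟩ := Ideal.mem_span_pair.mp hz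
    have hdeg : f.degree = d := by rw [degree_eq_natDegree hf.ne_zero, hfd]
    have hlt : ∀ q : k[X][X], (q %ₘ f).degree < d := fun q => hdeg ▸ degree_modByMonic_lt q hf
    -- The quotients of the two reductions modulo `f` are absorbed into the multiplier of `f`.
    set α₀ := α + (β /ₘ f) * g + (γ /ₘ f) * C h with hα₀
    have hx' : (x : k[X][X]) = f * α₀ + g * (β %ₘ f) + h • (γ %ₘ f) := by
      rw [hx, smul_eq_C_mul]
      have h1 := modByMonic_add_div β f
      have h2 := modByMonic_add_div γ f
      linear_combination -g * h1 - C h * h2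
    have hγ : γ %ₘ f ∈ degreeLT k[X] (d + d) :=
      mem_degreeLT.mpr ((hlt γ).trans_le (by exact_mod_cast Nat.le_add_right d d))
    have hβ : g * (β %ₘ f) ∈ degreeLT k[X] (d + d) := by
      rw [mem_degreeLT]
      rcases eq_or_ne g 0 with rfl | hg0
      · simp
      refine (degree_mul_le _ _).trans_lt ?_
      rw [Nat.cast_add]
      exact WithBot.add_lt_add_of_le_of_lt (degree_ne_bot.mpr hg0) (degree_le_of_natDegree_le hgd)
        (hlt β)
    have hα : f * α₀ ∈ degreeLT k[X] (d + d) := by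
      have : f * α₀ = x - g * (β %ₘ f) - h • (γ %ₘ f) := by rw [hx']; ring
      rw [this]
      exact sub_mem (sub_mem x.2 hβ) (Submodule.smul_mem _ _ hγ)
    -- All other terms have degree below 2d, hence so does `f * α₀`, and `f` is monic of degree d.
    have hα' : α₀ ∈ degreeLT k[X] d := by
      rw [mem_degreeLT] at hα ⊢
      rw [hf.degree_mul_comm, hf.degree_mul, hdeg, Nat.cast_add] at hα
      exact lt_of_add_lt_add_right hα
    refine Submodule.mem_sup.mpr ⟨sylvesterMap f g hfd.le hgd
      (⟨β %ₘ f, mem_degreeLT.mpr (hlt β)⟩, ⟨α₀, hα'⟩), ⟨_, rfl⟩, h • ⟨γ %ₘ f, hγ⟩,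
      Submodule.smul_mem_pointwise_smul _ _ _ trivial, ?_⟩
    ext1
    rw [hx']
    simp

theorem nonempty_quotient_equiv_of_ker_eq {R M Q : Type*} [CommRing R] [AddCommGroup M]
    [AddCommGroup Q] [Module R M] [Module R Q] (ψ : M →ₗ[R] Q) (hψ : Function.Surjective ψ)
    {W : Submodule R M} (h : LinearMap.ker ψ = W) : Nonempty ((M ⧸ W) ≃ₗ[R] Q) := by
  subst h
  exact ⟨ψ.quotKerEquivOfSurjective hψ⟩

theorem exists_linearEquiv_quotient_span {f g : k[X][X]} {d : ℕ} (hf : f.Monic)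
    (hfd : f.natDegree = d) (hgd : g.natDegree ≤ d) (h : k[X]) :
    Nonempty ((degreeLT k[X] (d + d) ⧸ (LinearMap.range (sylvesterMap f g hfd.le hgd) ⊔
      h • (⊤ : Submodule k[X] (degreeLT k[X] (d + d))))) ≃ₗ[k[X]]
      (k[X][X] ⧸ Ideal.span {f, g, C h})) := by
  let ψ : degreeLT k[X] (d + d) →ₗ[k[X]] k[X][X] ⧸ Ideal.span {f, g, C h} :=
    (Ideal.Quotient.mkₐ k[X] (Ideal.span {f, g, C h})).toLinearMap.comp
      (degreeLT k[X] (d + d)).subtype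
  have hker : LinearMap.ker ψ = LinearMap.range (sylvesterMap f g hfd.le hgd) ⊔
      h • (⊤ : Submodule k[X] (degreeLT k[X] (d + d))) := by
    ext x
    rw [mem_range_sylvesterMap_sup hf hfd hgd, LinearMap.mem_ker]
    exact Ideal.Quotient.eq_zero_iff_mem
  have hsurj : Function.Surjective ψ := by
    intro y
    obtain ⟨q, rfl⟩ := Ideal.Quotient.mk_surjective y
    refine ⟨⟨q %ₘ f, mem_degreeLT.mpr ((degree_modByMonic_lt q hf).trans_le ?_)⟩, ?_⟩
    · rw [degree_eq_natDegree hf.ne_zero, hfd]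
      exact_mod_cast Nat.le_add_right d d
    · refine Ideal.Quotient.eq.mpr ?_
      obtain ⟨c, hc⟩ := dvd_modByMonic_sub q f
      simp only [Submodule.subtype_apply]
      rw [hc]
      exact Ideal.mul_mem_right _ _ (Ideal.subset_span (by simp))
  exact nonempty_quotient_equiv_of_ker_eq ψ hsurj hker

theorem finrank_quotient_span_sylvester {f g : k[X][X]} {d : ℕ} (hf : f.Monic)
    (hfd : f.natDegree = d) (hgd : g.natDegree ≤ d) (hr : f.resultant g d d ≠ 0) (τ : k) {N : ℕ}
    (hN : (f.resultant g d d).rootMultiplicity τ ≤ N) :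
    Module.Finite k (k[X][X] ⧸ Ideal.span {f, g, C ((X - C τ) ^ N)}) ∧
    finrank k (k[X][X] ⧸ Ideal.span {f, g, C ((X - C τ) ^ N)}) =
      (f.resultant g d d).rootMultiplicity τ := by
  let b₁ := (((degreeLT.basis k[X] d).prod (degreeLT.basis k[X] d)).reindex finSumFinEquiv)
  let b₂ := degreeLT.basis k[X] (d + d)
  have hdet : (LinearMap.toMatrix b₁ b₂ (sylvesterMap f g hfd.le hgd)).det =
      f.resultant g d d := by
    rw [toMatrix_sylvesterMap', resultant]
  obtain ⟨E⟩ := exists_linearEquiv_quotient_span hf hfd hgd ((X - C τ) ^ N)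
  have key := finrank_coker_sup b₁ b₂ (sylvesterMap f g hfd.le hgd) (hdet ▸ hr) τ (hdet ▸ hN)
  rw [hdet] at key
  have := key.1
  exact ⟨Module.Finite.equiv (E.restrictScalars k), (E.restrictScalars k).finrank_eq ▸ key.2⟩

end Sylvester

/-! ### Decomposition of a finite quotient of the coordinate ring of the plane -/

section Decomposition

open MvPolynomial Module

variable {k : Type*} [Field k]

theorem pointIdeal_injective : Function.Injective (pointIdeal : (Fin 2 → k) → _) := by
  intro b b' h
  ext i
  have h1 : X i - C (b i) ∈ pointIdeal b := by simp [RingHom.mem_ker]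
  rw [h, RingHom.mem_ker] at h1
  simpa [sub_eq_zero, eq_comm] using h1

instance pointIdeal_isMaximal (b : Fin 2 → k) : (pointIdeal b).IsMaximal :=
  RingHom.ker_isMaximal_of_surjective _ fun c => ⟨C c, eval_C c⟩

theorem exists_eq_pointIdeal [IsAlgClosed k] (m : Ideal (MvPolynomial (Fin 2) k))
    [hm : m.IsMaximal] : ∃ b, m = pointIdeal b := by
  obtain ⟨x, hx⟩ := isMaximal_iff_eq_vanishingIdeal_singleton.mp hm
  refine ⟨x, hx.trans ?_⟩
  ext p
  rw [mem_vanishingIdeal_singleton_iff, RingHom.mem_ker]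
  rfl

variable {I : Ideal (MvPolynomial (Fin 2) k)}

/-- Localization commutes with quotients; the complement of `p` is the image of the complement of
the ideal of `b`. -/
theorem nonempty_localization_algEquiv {b : Fin 2 → k}
    (p : Ideal (MvPolynomial (Fin 2) k ⧸ I)) [p.IsPrime]
    (hp : p.comap (Ideal.Quotient.mk I) = pointIdeal b) :
    Nonempty (Localization.AtPrime p ≃ₐ[k]
      LocalRingAt b ⧸ I.map (algebraMap (MvPolynomial (Fin 2) k) (LocalRingAt b))) := by
  have hM : Algebra.algebraMapSubmonoid (MvPolynomial (Fin 2) k ⧸ I) (pointIdeal b).primeCompl =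
      p.primeCompl := by
    ext x
    constructor
    · rintro ⟨y, hy, rfl⟩
      intro h
      exact hy (hp ▸ h)
    · intro hx
      obtain ⟨y, rfl⟩ := Ideal.Quotient.mk_surjective x
      exact ⟨y, fun h => hx (by rw [← hp] at h; exact h), rfl⟩
  have h1 : IsLocalization (Algebra.algebraMapSubmonoid (MvPolynomial (Fin 2) k ⧸ I)
    (pointIdeal b).primeCompl)
      (LocalRingAt b ⧸ I.map (algebraMap (MvPolynomial (Fin 2) k) (LocalRingAt b))) :=
    inferInstance
  rw [hM] at h1
  let e := IsLocalization.algEquiv p.primeCompl (Localization.AtPrime p)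
    (LocalRingAt b ⧸ I.map (algebraMap (MvPolynomial (Fin 2) k) (LocalRingAt b)))
  exact ⟨AlgEquiv.ofRingEquiv (f := e.toRingEquiv) fun c => e.commutes (algebraMap k _ c)⟩

/-- The quotient is Artinian, hence the product of its localizations, and by the Nullstellensatz its
primes are the points at which `I` vanishes. -/
theorem finrank_quotient_eq_sum [IsAlgClosed k] [Module.Finite k (MvPolynomial (Fin 2) k ⧸ I)]
    (s : Finset (Fin 2 → k)) (hs : ∀ b, b ∈ s ↔ I ≤ pointIdeal b) :
    (finrank k (MvPolynomial (Fin 2) k ⧸ I) : ℕ∞) = ∑ b ∈ s, Module.length k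
      (LocalRingAt b ⧸ I.map (algebraMap (MvPolynomial (Fin 2) k) (LocalRingAt b))) := by
  have : IsArtinianRing (MvPolynomial (Fin 2) k ⧸ I) := IsArtinianRing.of_finite k _
  have := Fintype.ofFinite (PrimeSpectrum (MvPolynomial (Fin 2) k ⧸ I))
  rw [IsArtinianRing.finrank_eq_sum_primeSpectrum, Nat.cast_sum]
  have hex : ∀ p : PrimeSpectrum (MvPolynomial (Fin 2) k ⧸ I),
      ∃ b, p.asIdeal.comap (Ideal.Quotient.mk I) = pointIdeal b := by
    intro p
    have : p.asIdeal.IsMaximal := IsArtinianRing.isMaximal_of_isPrime p.asIdeal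
    have := Ideal.comap_isMaximal_of_surjective (Ideal.Quotient.mk I)
      Ideal.Quotient.mk_surjective (K := p.asIdeal)
    exact exists_eq_pointIdeal _
  choose β hβ using hex
  refine Finset.sum_bij (fun p _ => β p) (fun p _ => ?_) (fun p _ q _ h => ?_) (fun b hb => ?_)
    (fun p _ => ?_)
  · rw [hs, ← hβ]
    intro x hx
    rw [Ideal.mem_comap, Ideal.Quotient.eq_zero_iff_mem.mpr hx]
    exact zero_mem _
  · have h1 := (hβ p).trans ((congrArg pointIdeal h).trans (hβ q).symm)
    exact PrimeSpectrum.ext (Ideal.comap_injective_of_surjective _ Ideal.Quotient.mk_surjective h1)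
  · have hle := (hs b).mp hb
    have hprime : ((pointIdeal b).map (Ideal.Quotient.mk I)).IsPrime :=
      Ideal.map_isPrime_of_surjective Ideal.Quotient.mk_surjective (by rwa [Ideal.mk_ker])
    refine ⟨⟨_, hprime⟩, Finset.mem_univ _, pointIdeal_injective ?_⟩
    rw [← hβ, Ideal.comap_map_of_surjective _ Ideal.Quotient.mk_surjective,
      ← RingHom.ker_eq_comap_bot,
      Ideal.mk_ker, sup_eq_left.mpr hle]
  · obtain ⟨e⟩ := nonempty_localization_algEquiv p.asIdeal (hβ p)
    have : Module.Finite k (Localization.AtPrime p.asIdeal) :=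
      Module.Finite.of_surjective
        (Algebra.algHom k (MvPolynomial (Fin 2) k ⧸ I) (Localization.AtPrime p.asIdeal)).toLinearMap
        (IsArtinianRing.localization_surjective p.asIdeal.primeCompl _)
    have hlen : Module.length k (Localization.AtPrime p.asIdeal) =
      Module.length k (LocalRingAt (β p) ⧸
      I.map (algebraMap (MvPolynomial (Fin 2) k) (LocalRingAt (β p)))) :=
      LinearEquiv.length_eq e.toLinearEquiv
    rw [← hlen, Module.length_eq_finrank]

end Decomposition

/-! ### Intersection multiplicities over a point of the line and the resultant -/

section LocalResultant

open MvPolynomial Module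

variable {k : Type*} [Field k]

/-- A polynomial in two variables, read as a polynomial in the second variable. -/
def asPoly₂ (k : Type*) [Field k] : MvPolynomial (Fin 2) k ≃ₐ[k] Polynomial (Polynomial k) :=
  AlgEquiv.ofAlgHom (aeval ![Polynomial.C Polynomial.X, Polynomial.X])
    { Polynomial.eval₂RingHom (Polynomial.aeval (X 0) : Polynomial k →ₐ[k] _).toRingHom
        (X 1 : MvPolynomial (Fin 2) k) with
      commutes' := fun c => by
        simp [MvPolynomial.algebraMap_eq] }
    (by ext i <;> simp)
    (by ext i; fin_cases i <;> simp)

@[simp]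
theorem asPoly₂_X_zero : asPoly₂ k (X 0) = Polynomial.C Polynomial.X := by
  simp [asPoly₂]

@[simp]
theorem asPoly₂_X_one : asPoly₂ k (X 1) = Polynomial.X := by
  simp [asPoly₂]

@[simp]
theorem asPoly₂_C (c : k) : asPoly₂ k (C c) = Polynomial.C (Polynomial.C c) :=
  (asPoly₂ k).commutes c

theorem asPoly₂_aeval_X_zero (q : Polynomial k) :
    asPoly₂ k (Polynomial.aeval (X 0) q) = Polynomial.C q := by
  have : ((asPoly₂ k : MvPolynomial (Fin 2) k →ₐ[k] Polynomial (Polynomial k)).comp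
      (Polynomial.aeval (X 0))) = IsScalarTower.toAlgHom k (Polynomial k) _ := by
    ext; simp
  exact DFunLike.congr_fun this q

theorem C_resultant_mem_span {f g : Polynomial (Polynomial k)} {d : ℕ} {c : k} (hc : c ≠ 0)
    (hfd : f.natDegree ≤ d) (hfc : f.coeff d = Polynomial.C c) (hgd : g.natDegree ≤ d) :
    Polynomial.C (f.resultant g d d) ∈ Ideal.span {f, g} := by
  -- For d = 0 the resultant is 1 and is not a combination of `f` and `g` for degree reasons; here
  -- `f` is a nonzero constant and the ideal is everything.
  rcases eq_or_ne d 0 with rfl | hd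
  · have h1 : f = Polynomial.C (Polynomial.C c) := by
      rw [Polynomial.eq_C_of_natDegree_le_zero hfd, hfc]
    have h2 : IsUnit f := by
      rw [h1]
      exact ((Ne.isUnit hc).map Polynomial.C).map Polynomial.C
    rw [Ideal.eq_top_of_isUnit_mem _ (Ideal.subset_span (by simp)) h2]
    trivial
  · obtain ⟨p, q, -, -, h⟩ :=
      Polynomial.exists_mul_add_mul_eq_C_resultant f g hfd hgd (Or.inl hd)
    exact Ideal.mem_span_pair.mpr ⟨p, q, by rw [← h]; ring⟩

theorem finrank_quotient_span_resultant {f g : Polynomial (Polynomial k)} {d : ℕ} {c : k}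
    (hc : c ≠ 0) (hfd : f.natDegree ≤ d) (hfc : f.coeff d = Polynomial.C c) (hgd : g.natDegree ≤ d)
    (hr : f.resultant g d d ≠ 0) (τ : k) {N : ℕ}
    (hN : (f.resultant g d d).rootMultiplicity τ ≤ N) :
    Module.Finite k (Polynomial (Polynomial k) ⧸
      Ideal.span {f, g, Polynomial.C ((Polynomial.X - Polynomial.C τ) ^ N)}) ∧
    finrank k (Polynomial (Polynomial k) ⧸
      Ideal.span {f, g, Polynomial.C ((Polynomial.X - Polynomial.C τ) ^ N)}) =
      (f.resultant g d d).rootMultiplicity τ := by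
  set f' := Polynomial.C (Polynomial.C c⁻¹) * f with hf'
  have hcu : IsUnit (Polynomial.C c⁻¹ : Polynomial k) :=
    (Ne.isUnit (inv_ne_zero hc)).map Polynomial.C
  have hd' : f'.natDegree ≤ d := (Polynomial.natDegree_C_mul_le _ _).trans hfd
  have hc' : f'.coeff d = 1 := by
    rw [hf', Polynomial.coeff_C_mul, hfc, ← map_mul, inv_mul_cancel₀ hc, map_one]
  have hmonic : f'.Monic := Polynomial.monic_of_natDegree_le_of_coeff_eq_one d hd' hc'
  have hdeg : f'.natDegree = d :=
    le_antisymm hd' (Polynomial.le_natDegree_of_ne_zero (by rw [hc']; exact one_ne_zero))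
  have hass : Associated (f'.resultant g d d) (f.resultant g d d) := by
    rw [hf', Polynomial.resultant_C_mul_left]
    exact associated_unit_mul_left _ _ (hcu.pow d)
  have hspan : Ideal.span {f', g, Polynomial.C ((Polynomial.X - Polynomial.C τ) ^ N)} =
      Ideal.span {f, g, Polynomial.C ((Polynomial.X - Polynomial.C τ) ^ N)} := by
    rw [Ideal.span_insert, Ideal.span_insert, hf',
      Ideal.span_singleton_mul_left_unit (hcu.map Polynomial.C), Ideal.span_insert f]
    rw [Ideal.span_insert]
  have hmul := rootMultiplicity_eq_of_associated τ hass hr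
  have key := finrank_quotient_span_sylvester hmonic hdeg hgd (hass.ne_zero_iff.mpr hr) τ
    (N := N) (hmul ▸ hN)
  rwa [hspan, hmul] at key

theorem length_quotient_congr {A : Type*} [CommRing A] [Algebra k A] {J J' : Ideal A}
    (h : J = J') : Module.length k (A ⧸ J) = Module.length k (A ⧸ J') := by
  subst h
  rfl

theorem isUnit_algebraMap_localRingAt {b : Fin 2 → k} {f : MvPolynomial (Fin 2) k}
    (h : eval b f ≠ 0) : IsUnit (algebraMap (MvPolynomial (Fin 2) k) (LocalRingAt b) f) :=
  IsLocalization.map_units (M := (pointIdeal b).primeCompl) (LocalRingAt b) ⟨f, h⟩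

/-- Write r = (X - b 0)^e u. The factor u does not vanish at the point, so it is a unit in the local
ring, and the power alone lies in the ideal. -/
theorem pow_mem_span_localRingAt {f g : MvPolynomial (Fin 2) k} {r : Polynomial k} (hr : r ≠ 0)
    (hmem : Polynomial.C r ∈ Ideal.span {asPoly₂ k f, asPoly₂ k g}) {b : Fin 2 → k} :
    algebraMap (MvPolynomial (Fin 2) k) (LocalRingAt b)
      ((X 0 - C (b 0)) ^ r.rootMultiplicity (b 0)) ∈ Ideal.span
      {algebraMap (MvPolynomial (Fin 2) k) (LocalRingAt b) f,
        algebraMap (MvPolynomial (Fin 2) k) (LocalRingAt b) g} := by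
  obtain ⟨p, q, h⟩ := Ideal.mem_span_pair.mp hmem
  have h1 : (asPoly₂ k).symm p * f + (asPoly₂ k).symm q * g = Polynomial.aeval (X 0) r := by
    apply (asPoly₂ k).injective
    rw [asPoly₂_aeval_X_zero, ← h]
    simp
  obtain ⟨u, hu, hdvd⟩ := Polynomial.exists_eq_pow_rootMultiplicity_mul_and_not_dvd r hr (b 0)
  have hev : eval b (Polynomial.aeval (X 0) u) ≠ 0 := by
    have h1 : eval b (Polynomial.aeval (X 0) u) = u.eval (b 0) := by
      have := Polynomial.aeval_algHom_apply (aeval b : MvPolynomial (Fin 2) k →ₐ[k] k) (X 0) u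
      simpa [coe_aeval_eq_eval] using this.symm
    rw [h1]
    rw [Polynomial.dvd_iff_isRoot] at hdvd
    simpa using hdvd
  have h2 : Polynomial.aeval (X 0 : MvPolynomial (Fin 2) k) r =
      (X 0 - C (b 0)) ^ r.rootMultiplicity (b 0) * Polynomial.aeval (X 0) u := by
    conv_lhs => rw [hu]
    simp [MvPolynomial.algebraMap_eq]
  have h3 := isUnit_algebraMap_localRingAt hev
  rw [← Ideal.mul_unit_mem_iff_mem _ h3, ← map_mul, ← h2, ← h1, map_add, map_mul, map_mul]
  exact Ideal.mem_span_pair.mpr ⟨_, _, rfl⟩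

variable [IsAlgClosed k]

/-- Adding a high power of X - τ to (f, g) keeps only the points over τ and leaves the local rings
there unchanged, because the resultant lies in (f, g). The dimension of the quotient is thus the sum
of multiplicities, and by the Sylvester computation it is the order of the resultant. -/
theorem rootMultiplicity_resultant_eq_sum {f g : MvPolynomial (Fin 2) k} {d : ℕ} {c : k}
    (hc : c ≠ 0) (hfd : (asPoly₂ k f).natDegree ≤ d)
    (hfc : (asPoly₂ k f).coeff d = Polynomial.C c) (hgd : (asPoly₂ k g).natDegree ≤ d)
    (hr : (asPoly₂ k f).resultant (asPoly₂ k g) d d ≠ 0) (τ : k) (s : Finset k)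
    (hs : ∀ a, a ∈ s ↔ eval ![τ, a] f = 0 ∧ eval ![τ, a] g = 0) :
    (((asPoly₂ k f).resultant (asPoly₂ k g) d d).rootMultiplicity τ : ℕ∞) =
      ∑ a ∈ s, affineIntersectionMultiplicity f g ![τ, a] := by
  set r := (asPoly₂ k f).resultant (asPoly₂ k g) d d with hrdef
  -- The extra 1 makes the exponent positive even if r(τ) ≠ 0, so that the zeros of `I` do lie over
  -- τ.
  set N := r.rootMultiplicity τ + 1 with hN
  set I : Ideal (MvPolynomial (Fin 2) k) := Ideal.span {f, g, (X 0 - C τ) ^ N} with hI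
  have hmap : Ideal.map (asPoly₂ k : MvPolynomial (Fin 2) k →+* _) I = Ideal.span {asPoly₂ k f,
      asPoly₂ k g, Polynomial.C ((Polynomial.X - Polynomial.C τ) ^ N)} := by
    rw [hI, Ideal.map_span, Set.image_insert_eq, Set.image_insert_eq, Set.image_singleton]
    simp [asPoly₂_C]
  have e : (MvPolynomial (Fin 2) k ⧸ I) ≃ₐ[k] Polynomial (Polynomial k) ⧸ Ideal.span {asPoly₂ k f,
      asPoly₂ k g, Polynomial.C ((Polynomial.X - Polynomial.C τ) ^ N)} :=
    Ideal.quotientEquivAlg _ _ (asPoly₂ k) hmap.symm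
  obtain ⟨hfin, hrank⟩ := finrank_quotient_span_resultant hc hfd hfc hgd hr τ (N := N)
    (Nat.le_succ _)
  have : Module.Finite k (MvPolynomial (Fin 2) k ⧸ I) := Module.Finite.equiv e.symm.toLinearEquiv
  have hcard : finrank k (MvPolynomial (Fin 2) k ⧸ I) = r.rootMultiplicity τ :=
    e.toLinearEquiv.finrank_eq.trans hrank
  have hmem : ∀ b : Fin 2 → k, I ≤ pointIdeal b ↔ eval b f = 0 ∧ eval b g = 0 ∧ b 0 = τ := by
    intro b
    rw [hI, Ideal.span_le, Set.insert_subset_iff, Set.insert_subset_iff, Set.singleton_subset_iff]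
    simp only [SetLike.mem_coe, RingHom.mem_ker, map_pow, map_sub, eval_X, eval_C]
    rw [pow_eq_zero_iff (by omega), sub_eq_zero]
  have hinj : Function.Injective fun a : k => (![τ, a] : Fin 2 → k) := fun a b h => by
    simpa using congrFun h 1
  rw [← hcard, finrank_quotient_eq_sum (s.map ⟨_, hinj⟩) fun b => ?_, Finset.sum_map]
  · refine Finset.sum_congr rfl fun a ha => ?_
    simp only [Function.Embedding.coeFn_mk, affineIntersectionMultiplicity]
    have hJ : I.map (algebraMap (MvPolynomial (Fin 2) k) (LocalRingAt ![τ, a])) = Ideal.span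
      {algebraMap (MvPolynomial (Fin 2) k) (LocalRingAt ![τ, a]) f,
        algebraMap (MvPolynomial (Fin 2) k) (LocalRingAt ![τ, a]) g} := by
      rw [hI, Ideal.map_span, Set.image_insert_eq, Set.image_insert_eq, Set.image_singleton]
      refine le_antisymm ?_ (Ideal.span_mono ?_)
      swap
      · rw [Set.insert_subset_iff, Set.singleton_subset_iff]
        exact ⟨by simp, by simp⟩
      rw [Ideal.span_le, Set.insert_subset_iff, Set.insert_subset_iff, Set.singleton_subset_iff]
      refine ⟨Ideal.subset_span (by simp), Ideal.subset_span (by simp), ?_⟩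
      rw [hN, pow_succ, map_mul]
      exact Ideal.mul_mem_right _ _ (pow_mem_span_localRingAt (b := ![τ, a]) hr
        (C_resultant_mem_span hc hfd hfc hgd))
    exact length_quotient_congr hJ
  · rw [hmem, Finset.mem_map]
    constructor
    · rintro ⟨a, ha, rfl⟩
      exact ⟨((hs a).mp ha).1, ((hs a).mp ha).2, rfl⟩
    · rintro ⟨h1, h2, h3⟩
      have hb : ![τ, b 1] = b := by
        ext i; fin_cases i <;> simp [h3]
      exact ⟨b 1, (hs _).mpr (by rw [hb]; exact ⟨h1, h2⟩), hb⟩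

end LocalResultant

/-! ### Independence of the affine chart -/

section Charts

open MvPolynomial

variable {F : Type*} [Field F]

/-- The value of a germ at the point. -/
def localEval (b : Fin 2 → F) : LocalRingAt b →ₐ[F] F :=
  IsLocalization.liftAlgHom (M := (pointIdeal b).primeCompl)
    (f := (aeval b : MvPolynomial (Fin 2) F →ₐ[F] F)) fun y => Ne.isUnit y.2

@[simp]
theorem localEval_algebraMap (b : Fin 2 → F) (f : MvPolynomial (Fin 2) F) :
    localEval b (algebraMap _ (LocalRingAt b) f) = eval b f :=
  IsLocalization.lift_eq _ f

theorem isUnit_of_localEval_ne_zero {b : Fin 2 → F} {x : LocalRingAt b} (h : localEval b x ≠ 0) :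
    IsUnit x := by
  obtain ⟨⟨p, q⟩, hpq⟩ := IsLocalization.surj (pointIdeal b).primeCompl x
  have h1 := congrArg (localEval b) hpq
  rw [map_mul, localEval_algebraMap, localEval_algebraMap] at h1
  have h2 : eval b p ≠ 0 := by
    rw [← h1]
    exact mul_ne_zero h q.2
  have h3 := isUnit_algebraMap_localRingAt h2
  rw [← hpq] at h3
  exact isUnit_of_mul_isUnit_left h3

variable {a : Fin 3 → F}

/-- The homogeneous coordinates, normalized in the chart `t_j ≠ 0`, as germs at a point. -/
def coordGerm (a : Fin 3 → F) (j l : Fin 3) : LocalRingAt (affineCoord j a) :=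
  algebraMap _ _ (dehomogenize j (X l : MvPolynomial (Fin 3) F))

theorem coordGerm_self (j : Fin 3) : coordGerm a j j = 1 := by
  simp [coordGerm, dehomogenize]

theorem coordGerm_succAbove (j : Fin 3) (m : Fin 2) :
    coordGerm a j (j.succAbove m) = algebraMap _ _ (X m : MvPolynomial (Fin 2) F) := by
  simp [coordGerm, dehomogenize]

theorem localEval_coordGerm {j : Fin 3} (hj : a j ≠ 0) (l : Fin 3) :
    localEval (affineCoord j a) (coordGerm a j l) = a l / a j := by
  induction l using Fin.succAboveCases j with
  | x => simp [coordGerm_self, hj]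
  | p m => simp [coordGerm_succAbove, affineCoord]

theorem aeval_coordGerm (j : Fin 3) (f : MvPolynomial (Fin 3) F) :
    aeval (coordGerm a j) f = algebraMap _ (LocalRingAt (affineCoord j a)) (dehomogenize j f) := by
  have : aeval (coordGerm a j) = (IsScalarTower.toAlgHom F (MvPolynomial (Fin 2) F)
      (LocalRingAt (affineCoord j a))).comp (dehomogenize j) := by
    ext l
    simp [coordGerm]
  exact DFunLike.congr_fun this f

theorem isUnit_coordGerm {i j : Fin 3} (hi : a i ≠ 0) (hj : a j ≠ 0) :
    IsUnit (coordGerm a j i) :=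
  isUnit_of_localEval_ne_zero (by rw [localEval_coordGerm hj]; exact div_ne_zero hi hj)

/-- The affine coordinates of the chart `t_i ≠ 0` as germs in the chart `t_j ≠ 0`. -/
def chartHom (a : Fin 3 → F) (i j : Fin 3) :
    MvPolynomial (Fin 2) F →ₐ[F] LocalRingAt (affineCoord j a) :=
  aeval fun m => Ring.inverse (coordGerm a j i) * coordGerm a j (i.succAbove m)

theorem localEval_chartHom {i j : Fin 3} (hi : a i ≠ 0) (hj : a j ≠ 0)
    (f : MvPolynomial (Fin 2) F) :
    localEval (affineCoord j a) (chartHom a i j f) = eval (affineCoord i a) f := by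
  have h1 : localEval (affineCoord j a) (Ring.inverse (coordGerm a j i)) = a j / a i := by
    have h2 := congrArg (localEval (affineCoord j a))
      (Ring.inverse_mul_cancel _ (isUnit_coordGerm hi hj))
    rw [map_mul, localEval_coordGerm hj, map_one] at h2
    field_simp at h2 ⊢
    exact h2
  have : (localEval (affineCoord j a)).comp (chartHom a i j) =
      (aeval (affineCoord i a) : MvPolynomial (Fin 2) F →ₐ[F] F) := by
    ext m
    simp only [chartHom, AlgHom.comp_apply, aeval_X, map_mul, h1, localEval_coordGerm hj,
      affineCoord]
    field_simp
  exact DFunLike.congr_fun this f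

/-- The change of charts, on germs. -/
def chartMap {i j : Fin 3} (hi : a i ≠ 0) (hj : a j ≠ 0) :
    LocalRingAt (affineCoord i a) →ₐ[F] LocalRingAt (affineCoord j a) :=
  IsLocalization.liftAlgHom (M := (pointIdeal (affineCoord i a)).primeCompl) (f := chartHom a i j)
    fun y => isUnit_of_localEval_ne_zero (by rw [localEval_chartHom hi hj]; exact y.2)

theorem chartMap_algebraMap {i j : Fin 3} (hi : a i ≠ 0) (hj : a j ≠ 0)
    (f : MvPolynomial (Fin 2) F) :
    chartMap hi hj (algebraMap _ _ f) = chartHom a i j f :=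
  IsLocalization.lift_eq _ f

theorem chartMap_coordGerm {i j : Fin 3} (hi : a i ≠ 0) (hj : a j ≠ 0) (l : Fin 3) :
    chartMap hi hj (coordGerm a i l) = Ring.inverse (coordGerm a j i) * coordGerm a j l := by
  induction l using Fin.succAboveCases i with
  | x => rw [coordGerm_self, map_one, Ring.inverse_mul_cancel _ (isUnit_coordGerm hi hj)]
  | p m => rw [coordGerm_succAbove, chartMap_algebraMap, chartHom, aeval_X]

theorem chartMap_chartMap {i j : Fin 3} (hi : a i ≠ 0) (hj : a j ≠ 0)
    (x : LocalRingAt (affineCoord i a)) : chartMap hj hi (chartMap hi hj x) = x := by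
  have h1 : chartMap hj hi (Ring.inverse (coordGerm a j i)) * Ring.inverse (coordGerm a i j) =
      1 := by
    have := congrArg (chartMap hj hi) (Ring.inverse_mul_cancel _ (isUnit_coordGerm hi hj))
    rwa [map_mul, chartMap_coordGerm, coordGerm_self, mul_one, map_one] at this
  have h2 : (chartMap hj hi).comp (chartMap hi hj) = AlgHom.id F _ := by
    refine IsLocalization.algHom_ext (pointIdeal (affineCoord i a)).primeCompl ?_
    ext m
    have h3 : Algebra.algHom F (MvPolynomial (Fin 2) F) (LocalRingAt (affineCoord i a)) (X m) =
        coordGerm a i (i.succAbove m) := (coordGerm_succAbove i m).symm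
    simp only [AlgHom.comp_apply, AlgHom.id_apply, h3]
    rw [chartMap_coordGerm, map_mul, chartMap_coordGerm, ← mul_assoc, h1, one_mul]
  exact DFunLike.congr_fun h2 x

/-- The change of charts as an isomorphism of local rings. -/
def chartEquiv {i j : Fin 3} (hi : a i ≠ 0) (hj : a j ≠ 0) :
    LocalRingAt (affineCoord i a) ≃ₐ[F] LocalRingAt (affineCoord j a) :=
  AlgEquiv.ofAlgHom (chartMap hi hj) (chartMap hj hi)
    (AlgHom.ext (chartMap_chartMap hj hi)) (AlgHom.ext (chartMap_chartMap hi hj))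

/-- By homogeneity the two dehomogenizations differ by (t_j / t_i)^d, a unit at a point lying in
both charts. -/
theorem chartEquiv_dehomogenize {i j : Fin 3} (hi : a i ≠ 0) (hj : a j ≠ 0) {d : ℕ}
    {f : MvPolynomial (Fin 3) F} (hf : f.IsHomogeneous d) :
    ∃ u : LocalRingAt (affineCoord j a), IsUnit u ∧
      chartEquiv hi hj (algebraMap _ _ (dehomogenize i f)) =
        u * algebraMap _ _ (dehomogenize j f) := by
  refine ⟨Ring.inverse (coordGerm a j i) ^ d, (isUnit_coordGerm hi hj).ringInverse.pow d, ?_⟩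
  rw [← aeval_coordGerm, ← aeval_coordGerm, ← aeval_mul_of_isHomogeneous hf]
  have : (chartEquiv hi hj : LocalRingAt (affineCoord i a) →ₐ[F] _).comp (aeval (coordGerm a i)) =
      aeval fun l => Ring.inverse (coordGerm a j i) * coordGerm a j l := by
    ext l
    simp only [AlgHom.comp_apply, aeval_X]
    exact chartMap_coordGerm hi hj l
  exact DFunLike.congr_fun this f

theorem affineIntersectionMultiplicity_dehomogenize {i j : Fin 3} (hi : a i ≠ 0) (hj : a j ≠ 0)
    {d e : ℕ} {f g : MvPolynomial (Fin 3) F} (hf : f.IsHomogeneous d) (hg : g.IsHomogeneous e) :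
    affineIntersectionMultiplicity (dehomogenize i f) (dehomogenize i g) (affineCoord i a) =
      affineIntersectionMultiplicity (dehomogenize j f) (dehomogenize j g) (affineCoord j a) := by
  obtain ⟨u, hu, hfu⟩ := chartEquiv_dehomogenize hi hj hf
  obtain ⟨v, hv, hgv⟩ := chartEquiv_dehomogenize hi hj hg
  refine LinearEquiv.length_eq (Ideal.quotientEquivAlg _ _ (chartEquiv hi hj) ?_).toLinearEquiv
  rw [Ideal.map_span, Set.image_insert_eq, Set.image_singleton]
  simp only [RingHom.coe_coe, hfu, hgv]
  rw [Ideal.span_insert, Ideal.span_insert, Ideal.span_singleton_mul_left_unit hu,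
    Ideal.span_singleton_mul_left_unit hv]

theorem intersectionMultiplicity_eq (ha : a ≠ 0) {j : Fin 3} (hj : a j ≠ 0) {d e : ℕ}
    {f g : MvPolynomial (Fin 3) F} (hf : f.IsHomogeneous d) (hg : g.IsHomogeneous e) :
    intersectionMultiplicity f g a ha =
      affineIntersectionMultiplicity (dehomogenize j f) (dehomogenize j g) (affineCoord j a) :=
  affineIntersectionMultiplicity_dehomogenize (chartIndex_spec a ha) hj hf hg

end Charts

/-! ### Fibres of the projection from the point `(0 : 0 : 1)` -/

section Fibres

open MvPolynomial

variable {K : Type*} [Field K]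

/-- The point `(α : β : s)` of the plane, where `(α : β)` is a point of the projective line. -/
def planeRep {S : Type*} [CommRing S] [Algebra K S] (o : Option K) (s : S) : Fin 3 → S :=
  ![algebraMap K S (lineRep o 0), algebraMap K S (lineRep o 1), s]

/-- The restriction of a ternary form to a line through `(0 : 0 : 1)`. -/
def fibre {S : Type*} [CommRing S] [Algebra K S] (o : Option K) (f : MvPolynomial (Fin 3) S) :
    Polynomial S :=
  (asPoly f).map (lineEval S o)

variable {S : Type*} [CommRing S] [Algebra K S]

theorem eval_fibre (o : Option K) (f : MvPolynomial (Fin 3) S) (s : S) :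
    (fibre o f).eval s = eval (planeRep o s) f := by
  have : ((Polynomial.evalRingHom s).comp (Polynomial.mapRingHom (lineEval S o))).comp
      (asPoly : MvPolynomial (Fin 3) S →ₐ[S] _).toRingHom = eval (planeRep o s) := by
    ext i
    · simp [asPoly, lineEval]
    · fin_cases i <;> simp [asPoly, lineEval, planeRep]
  exact DFunLike.congr_fun this f

theorem natDegree_fibre_le (o : Option K) {f : MvPolynomial (Fin 3) S} {d : ℕ}
    (hf : f.IsHomogeneous d) : (fibre o f).natDegree ≤ d :=
  Polynomial.natDegree_map_le.trans (natDegree_asPoly_le hf)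

theorem coeff_fibre (o : Option K) {f : MvPolynomial (Fin 3) S} {d : ℕ} (hf : f.IsHomogeneous d) :
    (fibre o f).coeff d = eval ![0, 0, 1] f := by
  rw [fibre, Polynomial.coeff_map, coeff_asPoly_self hf, lineEval, eval_C]

theorem lineEval_formRes (o : Option K) (d : ℕ) (f g : MvPolynomial (Fin 3) S) :
    lineEval S o (formRes d f g) = (fibre o f).resultant (fibre o g) d d := by
  rw [formRes, fibre, fibre, Polynomial.resultant_map_map]

/-- A power of the leading coefficient of `f` times the product of the values of `g` at the roots of
`f`. The degree of `g` may drop, but not that of `f`. -/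
theorem resultant_ne_zero_iff_of_coeff_ne_zero {k : Type*} [Field k] [IsAlgClosed k]
    {f g : Polynomial k} {d : ℕ} (hf : f.natDegree ≤ d) (hfc : f.coeff d ≠ 0)
    (hg : g.natDegree ≤ d) : f.resultant g d d ≠ 0 ↔ ∀ s, f.eval s = 0 → g.eval s ≠ 0 := by
  have hd : f.natDegree = d := le_antisymm hf (Polynomial.le_natDegree_of_ne_zero hfc)
  have hf0 : f ≠ 0 := fun h => hfc (by simp [h])
  have h1 := Polynomial.resultant_eq_prod_eval f g d hg (IsAlgClosed.splits f)
  rw [hd] at h1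
  rw [h1, ne_eq, mul_eq_zero, Multiset.prod_eq_zero_iff]
  simp [hf0]

theorem lineEval_formRes_ne_zero_iff {k : Type*} [Field k] [IsAlgClosed k] [Algebra K k]
    (o : Option K) {d : ℕ} {f g : MvPolynomial (Fin 3) k} (hf : f.IsHomogeneous d)
    (hg : g.IsHomogeneous d) (hf0 : eval ![0, 0, 1] f ≠ 0) :
    lineEval k o (formRes d f g) ≠ 0 ↔
      ∀ s, eval (planeRep o s) f = 0 → eval (planeRep o s) g ≠ 0 := by
  rw [lineEval_formRes, resultant_ne_zero_iff_of_coeff_ne_zero (natDegree_fibre_le o hf)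
    (by rwa [coeff_fibre o hf]) (natDegree_fibre_le o hg)]
  simp only [eval_fibre]

theorem finite_fibre_zeros [IsDomain S] (o : Option K) {d : ℕ} {f : MvPolynomial (Fin 3) S}
    (hf : f.IsHomogeneous d) (hf0 : eval ![0, 0, 1] f ≠ 0) :
    {s : S | eval (planeRep o s) f = 0}.Finite := by
  have h : fibre o f ≠ 0 := fun h => hf0 (by rw [← coeff_fibre o hf, h, Polynomial.coeff_zero])
  refine (Polynomial.finite_setOfPred_isRoot h).subset fun s hs => ?_
  rw [Set.mem_ofPred_eq, Polynomial.IsRoot, eval_fibre]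
  exact hs

theorem lineEval_lineForm_eq_zero_iff [Nontrivial S] (o o' : Option K) :
    lineEval S o (map (algebraMap K S) (lineForm o')) = 0 ↔ o' = o := by
  have h := FaithfulSMul.algebraMap_injective K S
  constructor
  · intro h0
    cases o <;> cases o' <;> simp [lineEval, lineForm, lineRep] at h0 ⊢
    rw [sub_eq_zero] at h0
    exact (h h0).symm
  · rintro rfl
    cases o' <;> simp [lineEval, lineForm, lineRep]

theorem lineEval_prod_eq_zero_iff [IsDomain S] (o : Option K) (ms : Multiset (Option K)) :
    lineEval S o (map (algebraMap K S) (ms.map lineForm).prod) = 0 ↔ o ∈ ms := by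
  rw [map_multiset_prod, map_multiset_prod, Multiset.prod_eq_zero_iff]
  simp [lineEval_lineForm_eq_zero_iff]

theorem finite_lineEval_zeros [IsDomain S] {N : ℕ} {f : MvPolynomial (Fin 2) S}
    (hf : f.IsHomogeneous N) (h0 : f ≠ 0) : {o : Option K | lineEval S o f = 0}.Finite := by
  obtain ⟨ms, n, g, -, rfl, hg⟩ := exists_lineForm_factorization (K := K) hf h0
  classical
  refine ms.toFinset.finite_toSet.subset fun o ho => ?_
  rw [Set.mem_ofPred_eq, map_mul, mul_eq_zero] at ho
  simpa [lineEval_prod_eq_zero_iff, hg o] using ho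

end Fibres

/-! ### The linear system spanned by four forms -/

section Members

open MvPolynomial

variable {K : Type*} [Field K] {S : Type*} [CommRing S] [Algebra K S]

/-- The linear combination of the forms `p i` with coefficients `u i`. -/
def member (p : Fin 4 → MvPolynomial (Fin 3) K) (u : Fin 4 → S) : MvPolynomial (Fin 3) S :=
  ∑ i, C (u i) * map (algebraMap K S) (p i)

variable {p : Fin 4 → MvPolynomial (Fin 3) K} {d : ℕ}

theorem isHomogeneous_member (hhom : ∀ i, (p i).IsHomogeneous d) (u : Fin 4 → S) :
    (member p u).IsHomogeneous d :=
  IsHomogeneous.sum _ _ _ fun i _ => ((hhom i).map _).C_mul _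

theorem map_member {S' : Type*} [CommRing S'] [Algebra K S'] (φ : S →ₐ[K] S') (u : Fin 4 → S) :
    map φ.toRingHom (member p u) = member p fun i => φ (u i) := by
  simp [member, map_map]

theorem eval_member (b : Fin 3 → S) (u : Fin 4 → S) :
    eval b (member p u) = ∑ i, u i * aeval b (p i) := by
  simp [member, eval_map, aeval_def]

/-- The resultant with respect to the last variable of two members of a linear system. -/
def memberRes (d : ℕ) (p : Fin 4 → MvPolynomial (Fin 3) K) (u v : Fin 4 → S) :
    MvPolynomial (Fin 2) S :=
  formRes d (member p u) (member p v)

theorem isHomogeneous_memberRes (hhom : ∀ i, (p i).IsHomogeneous d) (u v : Fin 4 → S) :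
    (memberRes d p u v).IsHomogeneous (d * d) :=
  isHomogeneous_formRes (isHomogeneous_member hhom u) (isHomogeneous_member hhom v)

theorem map_memberRes {S' : Type*} [CommRing S'] [Algebra K S'] (φ : S →ₐ[K] S')
    (u v : Fin 4 → S) :
    map φ.toRingHom (memberRes d p u v) = memberRes d p (fun i => φ (u i)) fun i => φ (v i) := by
  rw [memberRes, ← formRes_map, map_member, map_member, memberRes]

theorem lineEval_memberRes_ne_zero_iff {k : Type*} [Field k] [IsAlgClosed k] [Algebra K k]
    (hhom : ∀ i, (p i).IsHomogeneous d) (o : Option K) (u v : Fin 4 → k)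
    (hu : ∑ i, u i * aeval (![0, 0, 1] : Fin 3 → k) (p i) ≠ 0) :
    lineEval k o (memberRes d p u v) ≠ 0 ↔ ∀ s : k,
      ∑ i, u i * aeval (planeRep o s) (p i) = 0 → ∑ i, v i * aeval (planeRep o s) (p i) ≠ 0 := by
  rw [memberRes, lineEval_formRes_ne_zero_iff o (isHomogeneous_member hhom u)
    (isHomogeneous_member hhom v) (by rwa [eval_member])]
  simp only [eval_member]

variable (K) in
/-- The polynomial ring in the coefficients of two members of the linear system. -/
abbrev PairRing : Type _ := MvPolynomial (Fin 4 ⊕ Fin 4) K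

/-- The resultant of two generic members of the linear system. -/
def genericRes (d : ℕ) (p : Fin 4 → MvPolynomial (Fin 3) K) : MvPolynomial (Fin 2) (PairRing K) :=
  memberRes d p (fun i => X (Sum.inl i)) fun i => X (Sum.inr i)

theorem map_genericRes (u v : Fin 4 → S) :
    map (aeval (Sum.elim u v) : PairRing K →ₐ[K] S).toRingHom (genericRes d p) =
      memberRes d p u v := by
  rw [genericRes, map_memberRes]
  simp

end Members

/-! ### General members of a linear system without fixed components -/

section GeneralMembers

open MvPolynomial

/-- Ternary polynomials as polynomials in the last variable. -/
def asPolyEquiv (S : Type*) [CommRing S] :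
    MvPolynomial (Fin 3) S ≃ₐ[S] Polynomial (MvPolynomial (Fin 2) S) :=
  AlgEquiv.ofAlgHom asPoly
    { Polynomial.eval₂RingHom (aeval ![X 0, X 1] : MvPolynomial (Fin 2) S →ₐ[S] _).toRingHom
        (X 2 : MvPolynomial (Fin 3) S) with
      commutes' := fun c => by simp [MvPolynomial.algebraMap_eq] }
    (by ext i <;> [skip; simp [asPoly]]; fin_cases i <;> simp [asPoly])
    (by ext i; fin_cases i <;> simp [asPoly])

variable {K : Type*} [Field K] {p : Fin 4 → MvPolynomial (Fin 3) K} {d : ℕ}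

theorem exists_eval_ne_zero [Infinite K] {σ : Type*} {P : MvPolynomial σ K} (h : P ≠ 0) :
    ∃ x, eval x P ≠ 0 := by
  by_contra! h'
  exact h (funext fun x => by rw [h', map_zero])

/-- K[t_1, t_2] is integrally closed, so if all the forms vanished at ρ, the minimal polynomial of ρ
would be a nonunit common factor. -/
theorem exists_aeval_ne_zero (hgcd : ∀ q : MvPolynomial (Fin 3) K, (∀ i, q ∣ p i) → IsUnit q)
    {E : Type*} [Field E] [Algebra (MvPolynomial (Fin 2) K) E]
    [FaithfulSMul (MvPolynomial (Fin 2) K) E] {ρ : E} (hρ : IsIntegral (MvPolynomial (Fin 2) K) ρ) :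
    ∃ i, Polynomial.aeval ρ (asPoly (p i)) ≠ 0 := by
  by_contra! h
  refine minpoly.not_isUnit (MvPolynomial (Fin 2) K) ρ ?_
  have h1 : ∀ i, minpoly (MvPolynomial (Fin 2) K) ρ ∣ asPolyEquiv K (p i) := fun i =>
    minpoly.isIntegrallyClosed_dvd hρ (h i)
  have h2 := hgcd ((asPolyEquiv K).symm (minpoly (MvPolynomial (Fin 2) K) ρ)) fun i => by
    have := map_dvd (asPolyEquiv K).symm (h1 i)
    rwa [AlgEquiv.symm_apply_apply] at this
  simpa using h2.map (asPolyEquiv K)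

/-- Over an algebraic closure of K(t_1, t_2), each of the finitely many roots ρ of `p 3` is
integral, its leading coefficient being constant. Combinations of `p 0`, `p 1`, `p 2` vanishing at ρ
form a proper subspace of K³, and finitely many proper subspaces do not cover K³ as `K` is infinite.
-/
theorem exists_memberRes_ne_zero [Infinite K] (hhom : ∀ i, (p i).IsHomogeneous d)
    (hgcd : ∀ q : MvPolynomial (Fin 3) K, (∀ i, q ∣ p i) → IsUnit q)
    (h3 : eval ![0, 0, 1] (p 3) ≠ 0) :
    ∃ a : Fin 4 → K, a 3 = 0 ∧ memberRes d p (![0, 0, 0, 1] : Fin 4 → K) a ≠ 0 := by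
  classical
  let E := AlgebraicClosure (FractionRing (MvPolynomial (Fin 2) K))
  let ι : MvPolynomial (Fin 2) K →+* E := algebraMap _ E
  have hι : Function.Injective ι := by
    have h1 : ι = (algebraMap (FractionRing (MvPolynomial (Fin 2) K)) E).comp
      (algebraMap _ (FractionRing (MvPolynomial (Fin 2) K))) := IsScalarTower.algebraMap_eq _ _ _
    rw [h1]
    exact (RingHom.injective (algebraMap (FractionRing (MvPolynomial (Fin 2) K)) E)).comp
      (IsFractionRing.injective _ (FractionRing (MvPolynomial (Fin 2) K)))
  have : FaithfulSMul (MvPolynomial (Fin 2) K) E :=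
    (faithfulSMul_iff_algebraMap_injective _ _).mpr hι
  set Q : Polynomial E := (asPoly (p 3)).map ι with hQ
  have hQc : Q.coeff d ≠ 0 := by
    rw [hQ, Polynomial.coeff_map, coeff_asPoly_self (hhom 3)]
    exact (map_ne_zero_iff _ hι).mpr ((map_ne_zero_iff _ (C_injective _ _)).mpr h3)
  have hQd : Q.natDegree ≤ d := Polynomial.natDegree_map_le.trans (natDegree_asPoly_le (hhom 3))
  have hQ0 : Q ≠ 0 := fun h => hQc (by rw [h, Polynomial.coeff_zero])
  have hroot : ∀ ρ ∈ Q.roots, Polynomial.aeval ρ (asPoly (p 3)) = 0 := fun ρ hρ => by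
    have := (Polynomial.mem_roots hQ0).mp hρ
    rwa [Polynomial.IsRoot, hQ, Polynomial.eval_map] at this
  have hint : ∀ ρ ∈ Q.roots, IsIntegral (MvPolynomial (Fin 2) K) ρ := fun ρ hρ => by
    refine ⟨Polynomial.C (C (eval ![0, 0, 1] (p 3))⁻¹) * asPoly (p 3), ?_, ?_⟩
    · refine Polynomial.monic_of_natDegree_le_of_coeff_eq_one d
        ((Polynomial.natDegree_C_mul_le _ _).trans (natDegree_asPoly_le (hhom 3))) ?_
      rw [Polynomial.coeff_C_mul, coeff_asPoly_self (hhom 3), ← C_mul, inv_mul_cancel₀ h3, C_1]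
    · have := hroot ρ hρ
      rw [Polynomial.aeval_def] at this
      rw [Polynomial.eval₂_mul, this, mul_zero]
  let W : E → Submodule K (Fin 3 → K) := fun ρ => LinearMap.ker
    (∑ j : Fin 3, (LinearMap.toSpanSingleton K E (Polynomial.aeval ρ (asPoly (p j.castSucc)))).comp
      (LinearMap.proj j))
  have hW : ∀ ρ a, a ∈ W ρ ↔
      ∑ j : Fin 3, a j • Polynomial.aeval ρ (asPoly (p j.castSucc)) = 0 := fun ρ a => by
    simp [W, LinearMap.mem_ker]
  have htop : (⊤ : Submodule K (Fin 3 → K)) ∉ Q.roots.toFinset.image W := by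
    intro h
    obtain ⟨ρ, hρ, h⟩ := Finset.mem_image.mp h
    rw [Multiset.mem_toFinset] at hρ
    obtain ⟨i, hi⟩ := exists_aeval_ne_zero hgcd (hint ρ hρ)
    induction i using Fin.lastCases with
    | last => exact hi (hroot ρ hρ)
    | cast j =>
      have hj : Pi.single j 1 ∈ W ρ := h ▸ Submodule.mem_top
      rw [hW] at hj
      exact hi (by simpa [Pi.single_apply] using hj)
  have := Subspace.biUnion_ne_univ_of_top_notMem htop
  obtain ⟨a, ha⟩ := (Set.ne_univ_iff_exists_notMem _).mp this
  refine ⟨Fin.snoc a 0, Fin.snoc_last _ _, fun h0 => ?_⟩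
  have hm3 : member p (![0, 0, 0, 1] : Fin 4 → K) = p 3 := by
    simp [member, Fin.sum_univ_four, map_id]
  have h1 := congrArg ι h0
  rw [map_zero, memberRes, formRes, ← Polynomial.resultant_map_map, hm3] at h1
  refine (resultant_ne_zero_iff_of_coeff_ne_zero hQd hQc (Polynomial.natDegree_map_le.trans
    (natDegree_asPoly_le (isHomogeneous_member hhom _)))).mpr ?_ h1
  intro ρ hρ h2
  refine ha (Set.mem_biUnion (x := W ρ) (Finset.mem_image_of_mem _
    (Multiset.mem_toFinset.mpr ((Polynomial.mem_roots hQ0).mpr hρ))) ?_)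
  rw [SetLike.mem_coe, hW]
  have hma : member p (Fin.snoc a 0 : Fin 4 → K) = ∑ j : Fin 3, C (a j) * p j.castSucc := by
    rw [member, Fin.sum_univ_castSucc, Fin.snoc_last]
    simp [map_id]
  rw [Polynomial.eval_map, ← Polynomial.aeval_def, hma, map_sum, map_sum] at h2
  have e : ∀ (b : K) (q : MvPolynomial (Fin 3) K), Polynomial.aeval ρ (asPoly (C b * q)) =
      b • Polynomial.aeval ρ (asPoly q) := fun b q => by
    rw [← smul_eq_C_mul, map_smul]
    exact map_smul ((Polynomial.aeval ρ).restrictScalars K) b (asPoly q)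
  simpa only [e] using h2

theorem genericRes_ne_zero [Infinite K] (hhom : ∀ i, (p i).IsHomogeneous d)
    (hgcd : ∀ q : MvPolynomial (Fin 3) K, (∀ i, q ∣ p i) → IsUnit q)
    (h3 : eval ![0, 0, 1] (p 3) ≠ 0) : genericRes d p ≠ 0 := fun h => by
  obtain ⟨a, -, ha⟩ := exists_memberRes_ne_zero hhom hgcd h3
  rw [← map_genericRes, h, map_zero] at ha
  exact ha rfl

end GeneralMembers

/-! ### Pencils attached to a matrix -/

section Pencils

open MvPolynomial

variable {K : Type*} [Field K]

theorem exists_forall_eval_ne_zero [Infinite K] {σ ι : Type*} (s : Finset ι)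
    {P : ι → MvPolynomial σ K} (h : ∀ i ∈ s, P i ≠ 0) : ∃ x, ∀ i ∈ s, eval x (P i) ≠ 0 := by
  obtain ⟨x, hx⟩ := exists_eval_ne_zero (Finset.prod_ne_zero_iff.mpr h)
  rw [map_prod] at hx
  exact ⟨x, Finset.prod_ne_zero_iff.mp hx⟩

/-- The coefficients of the linear form `x_3 L_k - x_k L_3`, where `L` is the linear map with
matrix `M`. -/
def pencil {S : Type*} [CommRing S] (M : Fin 4 → Fin 4 → S) (k : Fin 4) (x : Fin 4 → S) :
    Fin 4 → S :=
  fun j => x 3 * M k j - x k * M 3 j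

variable {S : Type*} [CommRing S] [Algebra K S]

/-- The specialization of the generic pair of members to the pair given by `M` and `x`. -/
def pencilEval (M : Fin 4 → Fin 4 → S) (x : Fin 4 → S) : PairRing K →ₐ[K] S :=
  aeval (Sum.elim (pencil M 0 x) (pencil M 2 x))

theorem map_pencilEval {S' : Type*} [CommRing S'] [Algebra K S'] (φ : S →ₐ[K] S')
    (M : Fin 4 → Fin 4 → S) (x : Fin 4 → S) (P : PairRing K) :
    φ (pencilEval M x P) = pencilEval (fun i j => φ (M i j)) (fun i => φ (x i)) P := by
  have : φ.comp (pencilEval M x) = pencilEval (fun i j => φ (M i j)) fun i => φ (x i) := by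
    ext i
    rcases i with i | i <;> simp [pencilEval, pencil]
  exact DFunLike.congr_fun this P

theorem lineEval_map_pencilEval (M : Fin 4 → Fin 4 → S) (x : Fin 4 → S) (o : Option K)
    (R : MvPolynomial (Fin 2) (PairRing K)) :
    lineEval S o (map (pencilEval M x).toRingHom R) =
      pencilEval M x (lineEval (PairRing K) o R) :=
  lineEval_map (pencilEval M x) o R

/-- If, for the matrix `M`, the specialized form vanishes identically over no point of the line,
then the same holds for all matrices outside of a hypersurface. -/
theorem exists_hypersurface [IsAlgClosed K] {R : MvPolynomial (Fin 2) (PairRing K)} {n : ℕ}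
    (hR : R.IsHomogeneous n) {M : Fin 4 → Fin 4 → K}
    (hM : ∀ o : Option K, ∃ ξ : Fin 4 → K, pencilEval M ξ (lineEval (PairRing K) o R) ≠ 0) :
    ∃ f : MvPolynomial (Fin 4 × Fin 4) K, eval (fun ij => M ij.1 ij.2) f ≠ 0 ∧
      ∀ N : Fin 4 → Fin 4 → K, eval (fun ij => N ij.1 ij.2) f ≠ 0 →
        ∀ o : Option K, ∃ ξ : Fin 4 → K, pencilEval N ξ (lineEval (PairRing K) o R) ≠ 0 := by
  obtain ⟨ξ, hξ⟩ := hM none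
  let G : (N : Fin 4 → Fin 4 → K) → (x : Fin 4 → K) → MvPolynomial (Fin 2) K :=
    fun N x => map (pencilEval N x).toRingHom R
  have hG : ∀ N x, (G N x).IsHomogeneous n := fun N x => hR.map _
  have hGl : ∀ N x o, lineEval K o (G N x) = pencilEval N x (lineEval (PairRing K) o R) :=
    fun N x o => lineEval_map_pencilEval N x o R
  have hξ0 : G M ξ ≠ 0 := fun h => hξ (by rw [← hGl, h, map_zero])
  choose ζ hζ using hM
  let Q : Option K → MvPolynomial (Fin 4) K := fun o =>
    pencilEval (fun i j => C (M i j)) X (lineEval (PairRing K) o R)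
  have hQ : ∀ x o, eval x (Q o) = pencilEval M x (lineEval (PairRing K) o R) := fun x o => by
    have := map_pencilEval (aeval x : MvPolynomial (Fin 4) K →ₐ[K] K) (fun i j => C (M i j)) X
      (lineEval (PairRing K) o R)
    simpa [Q] using this
  -- The form at ξ has finitely many zeros on the line, so a single η avoids vanishing at all of
  -- them.
  obtain ⟨η, hη⟩ := exists_forall_eval_ne_zero (finite_lineEval_zeros (hG M ξ) hξ0).toFinset
    (P := Q) fun o _ h => hζ o (by rw [← hQ, h, map_zero])
  let T := MvPolynomial (Fin 4 × Fin 4) K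
  let H : (Fin 4 → K) → MvPolynomial (Fin 2) T := fun x =>
    map (pencilEval (fun i j => (X (i, j) : T)) fun i => C (x i)).toRingHom R
  have hH : ∀ (N : Fin 4 → Fin 4 → K) x,
      map (eval fun ij : Fin 4 × Fin 4 => N ij.1 ij.2) (H x) = G N x := fun N x => by
    simp only [H, G, map_map]
    congr 2
    ext i
    · simp
    · rcases i with i | i <;> simp [pencilEval, pencil]
  -- The first factor says that the form at ξ is nonzero at (0 : 1), so its degree in the affine
  -- chart is full; the resultant then says that the forms at ξ and η share no zero in that chart.
  let f : T := lineEval T (none : Option K) (H ξ) *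
    Polynomial.resultant (lineChart T (some (0 : K)) (H ξ)) (lineChart T (some (0 : K)) (H η)) n n
  have hf : ∀ N : Fin 4 → Fin 4 → K, eval (fun ij : Fin 4 × Fin 4 => N ij.1 ij.2) f ≠ 0 ↔
      lineEval K (none : Option K) (G N ξ) ≠ 0 ∧
      ∀ τ : K, lineEval K (some τ) (G N ξ) = 0 → lineEval K (some τ) (G N η) ≠ 0 := fun N => by
    have h1 : eval (fun ij : Fin 4 × Fin 4 => N ij.1 ij.2) (lineEval T (none : Option K) (H ξ)) =
        lineEval K (none : Option K) (G N ξ) := by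
      have := lineEval_map (aeval (fun ij : Fin 4 × Fin 4 => N ij.1 ij.2) : T →ₐ[K] K)
        (none : Option K) (H ξ)
      rw [← hH]
      simpa using this.symm
    have h2 : ∀ x, (lineChart T (some (0 : K)) (H x)).map
        (eval fun ij : Fin 4 × Fin 4 => N ij.1 ij.2) = lineChart K (some (0 : K)) (G N x) :=
      fun x => by rw [← hH]; exact (lineChart_map _ _ _).symm
    rw [map_mul, mul_ne_zero_iff, h1, ← Polynomial.resultant_map_map, h2, h2]
    refine and_congr_right fun h0 => ?_
    rw [resultant_ne_zero_iff_of_coeff_ne_zero (natDegree_lineChart_le (hG N ξ) _)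
      (by rwa [coeff_lineChart (hG N ξ)]) (natDegree_lineChart_le (hG N η) _)]
    exact forall_congr' fun τ => by
      rw [← eval_lineChart (some τ), ← eval_lineChart (some τ)]
      rfl
  refine ⟨f, (hf M).mpr ⟨by rwa [hGl], fun τ hτ => ?_⟩, fun N hN o => ?_⟩
  · rw [hGl, ← hQ]
    exact hη _ ((Set.Finite.mem_toFinset _).mpr hτ)
  · obtain ⟨h1, h2⟩ := (hf N).mp hN
    by_cases h : lineEval K o (G N ξ) = 0
    · cases o with
      | none => exact absurd h h1
      | some τ => exact ⟨η, by rw [← hGl]; exact h2 τ h⟩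
    · exact ⟨ξ, by rwa [← hGl]⟩

end Pencils

/-! ### A transformation in general position -/

section GeneralPosition

open MvPolynomial

variable {K : Type*} [Field K] {p : Fin 4 → MvPolynomial (Fin 3) K} {d : ℕ}

theorem eval_aeval_sumElim (u v : Fin 4 → K) (P : PairRing K) :
    eval v (aeval (Sum.elim (fun i => C (u i)) X : Fin 4 ⊕ Fin 4 → MvPolynomial (Fin 4) K) P) =
      eval (Sum.elim u v) P := by
  have : (eval v).comp (aeval (Sum.elim (fun i => C (u i)) X :
      Fin 4 ⊕ Fin 4 → MvPolynomial (Fin 4) K) : PairRing K →ₐ[K] _).toRingHom =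
      eval (Sum.elim u v) := by
    ext i
    · simp
    · rcases i with i | i <;> simp
  exact DFunLike.congr_fun this P

/-- For general `u`, `p 3` and the combination of `p 0`, `p 1`, `p 2` by `u` meet in finitely many
points. Those over o ∉ s are not base points, so a general `v` is nonzero at each of them. -/
theorem exists_general_pair [IsAlgClosed K] (hhom : ∀ i, (p i).IsHomogeneous d)
    (hgcd : ∀ q : MvPolynomial (Fin 3) K, (∀ i, q ∣ p i) → IsUnit q)
    (h3 : eval ![0, 0, 1] (p 3) ≠ 0) (s : Finset (Option K)) {Φ : Option K → PairRing K}
    (hΦ : ∀ o ∈ s, Φ o ≠ 0)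
    (hs : ∀ o ∉ s, ∀ τ : K, ∃ i, aeval (planeRep o τ) (p i) ≠ 0) :
    ∃ u v : Fin 4 → K, (∀ o ∈ s, eval (Sum.elim u v) (Φ o) ≠ 0) ∧ u 0 * v 1 - u 1 * v 0 ≠ 0 ∧
      ∀ o ∉ s, ∀ τ : K, aeval (planeRep o τ) (p 3) = 0 →
        ∑ j : Fin 3, u j.castSucc * aeval (planeRep o τ) (p j.castSucc) = 0 →
        ∑ j : Fin 3, v j.castSucc * aeval (planeRep o τ) (p j.castSucc) ≠ 0 := by
  classical
  obtain ⟨a, ha3, ha⟩ := exists_memberRes_ne_zero hhom hgcd h3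
  let t : (Fin 4 → K) → Fin 4 → K := fun u => Fin.snoc (fun j => u j.castSucc) 0
  -- The resultant of `p 3` with a generic combination of the other three forms.
  let ρ : MvPolynomial (Fin 2) (PairRing K) := memberRes d p ![0, 0, 0, 1]
    (Fin.snoc (fun j : Fin 3 => X (Sum.inl j.castSucc)) 0 : Fin 4 → PairRing K)
  have hρ : ∀ u v : Fin 4 → K, map (eval (Sum.elim u v)) ρ =
      memberRes d p (![0, 0, 0, 1] : Fin 4 → K) (t u) := fun u v => by
    have := map_memberRes (d := d) (p := p) (aeval (Sum.elim u v) : PairRing K →ₐ[K] K)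
      ![0, 0, 0, 1] (Fin.snoc (fun j : Fin 3 => X (Sum.inl j.castSucc)) 0)
    have e : (aeval (Sum.elim u v) : PairRing K →ₐ[K] K).toRingHom = eval (Sum.elim u v) := by
      ext i <;> simp
    rw [e] at this
    rw [this]
    congr 1
    · ext i; fin_cases i <;> simp
    · ext i
      induction i using Fin.lastCases with
      | last => simp only [t, Fin.snoc_last, map_zero]
      | cast j => simp [t]
  have hρ0 : ρ ≠ 0 := fun h => by
    have h1 := hρ a 0
    have h2 : t a = a := by
      ext i
      induction i using Fin.lastCases with
      | last => simp only [t, Fin.snoc_last]; exact ha3.symm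
      | cast j => simp [t]
    rw [h, map_zero, h2] at h1
    exact ha h1.symm
  obtain ⟨m, hm⟩ := exists_coeff_ne_zero hρ0
  obtain ⟨w, hw⟩ := exists_eval_ne_zero (mul_ne_zero (mul_ne_zero (Finset.prod_ne_zero_iff.mpr hΦ)
    hm) (X_ne_zero (R := K) (Sum.inl 0 : Fin 4 ⊕ Fin 4)))
  obtain ⟨u, v₁, rfl⟩ : ∃ u v₁, w = Sum.elim u v₁ :=
    ⟨w ∘ Sum.inl, w ∘ Sum.inr, (Sum.elim_comp_inl_inr w).symm⟩
  rw [map_mul, map_mul, map_prod, mul_ne_zero_iff, mul_ne_zero_iff, Finset.prod_ne_zero_iff,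
    eval_X, Sum.elim_inl] at hw
  obtain ⟨⟨hw1, hw2⟩, hu0⟩ := hw
  have hr0 : memberRes d p (![0, 0, 0, 1] : Fin 4 → K) (t u) ≠ 0 := fun h => hw2 (by
    rw [← coeff_map, hρ, h, coeff_zero])
  have hZ : {z : Option K × K | aeval (planeRep z.1 z.2) (p 3) = 0 ∧
      ∑ j : Fin 3, u j.castSucc * aeval (planeRep z.1 z.2) (p j.castSucc) = 0}.Finite := by
    have h1 := finite_lineEval_zeros (K := K) (isHomogeneous_memberRes hhom _ _) hr0
    refine Set.Finite.subset (h1.biUnion fun o _ =>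
      ((finite_fibre_zeros o (hhom 3) h3).image fun τ => (o, τ))) fun z hz => ?_
    refine Set.mem_biUnion (x := z.1) ?_ ⟨z.2, ?_, rfl⟩
    · by_contra hne
      have := (lineEval_memberRes_ne_zero_iff hhom z.1 (![0, 0, 0, 1] : Fin 4 → K) (t u)
        (by simpa [Fin.sum_univ_four] using h3)).mp hne z.2 (by
          simpa [Fin.sum_univ_four] using hz.1)
      rw [Fin.sum_univ_castSucc] at this
      exact this (by
        simpa only [t, Fin.snoc_last, Fin.snoc_castSucc, zero_mul, add_zero] using hz.2)
    · simpa using hz.1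
  -- Three finite families of conditions on `v`: `v₁` witnesses that the Φ-conditions are
  -- nontrivial, a nonvanishing `p j` does so at each intersection point, and u 0 ≠ 0 does so for
  -- the minor.
  obtain ⟨v, hv⟩ := exists_forall_eval_ne_zero (K := K) (σ := Fin 4)
    ((s.disjSum (hZ.toFinset.filter fun z => z.1 ∉ s)).disjSum ({()} : Finset Unit))
    (P := Sum.elim (Sum.elim (fun o => aeval (Sum.elim (fun i => C (u i)) X) (Φ o))
      fun z => ∑ j : Fin 3, C (aeval (planeRep z.1 z.2) (p j.castSucc)) * X j.castSucc)
      fun _ => C (u 0) * X 1 - C (u 1) * X 0) (by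
    rintro ((o | z) | -) h
    · simp only [Finset.inl_mem_disjSum] at h
      intro h0
      have h1 := congrArg (eval v₁) h0
      rw [map_zero] at h1
      exact hw1 o h ((eval_aeval_sumElim u v₁ _).symm.trans h1)
    · simp only [Finset.inl_mem_disjSum, Finset.inr_mem_disjSum, Finset.mem_filter,
        Set.Finite.mem_toFinset] at h
      obtain ⟨i, hi⟩ := hs z.1 h.2 z.2
      induction i using Fin.lastCases with
      | last => exact absurd h.1.1 hi
      | cast j =>
        intro h0
        have h1 := congrArg (eval (Pi.single j.castSucc 1)) h0
        simp [Pi.single_apply] at h1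
        simp at hi
        exact hi h1
    · intro h0
      have h1 := congrArg (eval (Pi.single 1 1)) h0
      simp at h1
      exact hu0 h1)
  refine ⟨u, v, fun o ho => ?_, ?_, fun o ho τ h1 h2 => ?_⟩
  · have := hv (Sum.inl (Sum.inl o)) (by simpa using ho)
    rwa [Sum.elim_inl, Sum.elim_inl, eval_aeval_sumElim] at this
  · simpa using hv (Sum.inr ()) (by simp)
  · have := hv (Sum.inl (Sum.inr (o, τ))) (by simp [ho]; simpa using ⟨h1, h2⟩)
    simpa [mul_comm] using this

/-- A base point over o would be a common zero of every pair of members, making the generic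
resultant vanish at o. -/
theorem exists_aeval_planeRep_ne_zero [IsAlgClosed K] (hhom : ∀ i, (p i).IsHomogeneous d)
    (h3 : eval ![0, 0, 1] (p 3) ≠ 0) {o : Option K}
    (ho : lineEval (PairRing K) o (genericRes d p) ≠ 0) (τ : K) :
    ∃ i, aeval (planeRep o τ) (p i) ≠ 0 := by
  by_contra! h
  have h0 : (∑ i, C (aeval (![0, 0, 1] : Fin 3 → K) (p i)) * X (Sum.inl i) : PairRing K) ≠ 0 :=
    fun h => by
      have := congrArg (eval (Sum.elim (Pi.single 3 1) 0)) h
      simp [Pi.single_apply] at this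
      exact h3 this
  obtain ⟨w, hw⟩ := exists_eval_ne_zero (mul_ne_zero ho h0)
  obtain ⟨u, v, rfl⟩ : ∃ u v, w = Sum.elim u v :=
    ⟨w ∘ Sum.inl, w ∘ Sum.inr, (Sum.elim_comp_inl_inr w).symm⟩
  rw [map_mul, mul_ne_zero_iff] at hw
  have h1 : lineEval K o (memberRes d p u v) ≠ 0 := by
    rw [← map_genericRes, lineEval_map (aeval (Sum.elim u v)) o]
    simpa using hw.1
  refine (lineEval_memberRes_ne_zero_iff hhom o u v ?_).mp h1 τ ?_ ?_
  · simpa [mul_comm] using hw.2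
  · simp [h]
  · simp [h]

/-- Rows 0 and 2 carry the first three coefficients of a general pair, and varying x varies the
fourth ones freely. For o in `ms` the pair itself is attained; for other o the fourth coefficients
are adjusted to exclude common zeros over o. -/
theorem exists_general_matrix [IsAlgClosed K] (hhom : ∀ i, (p i).IsHomogeneous d)
    (hgcd : ∀ q : MvPolynomial (Fin 3) K, (∀ i, q ∣ p i) → IsUnit q)
    (h3 : eval ![0, 0, 1] (p 3) ≠ 0) {ms : Multiset (Option K)}
    {R : MvPolynomial (Fin 2) (PairRing K)}
    (hfac : genericRes d p = map (algebraMap K (PairRing K)) (ms.map lineForm).prod * R)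
    (hR : ∀ o : Option K, lineEval (PairRing K) o R ≠ 0) :
    ∃ M : GL (Fin 4) K, (M (Fin.last 3) (Fin.last 3) = 1 ∧
      ∀ i : Fin 3, M i.castSucc (Fin.last 3) = 0 ∧ M (Fin.last 3) i.castSucc = 0) ∧
      ∀ o : Option K, ∃ ξ : Fin 4 → K,
        pencilEval (fun i j => M i j) ξ (lineEval (PairRing K) o R) ≠ 0 := by
  classical
  have hne : ∀ o, lineEval (PairRing K) o (genericRes d p) ≠ 0 ↔ o ∉ ms := fun o => by
    rw [hfac, map_mul, mul_ne_zero_iff, ne_eq, lineEval_prod_eq_zero_iff]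
    exact and_iff_left (hR o)
  obtain ⟨u, v, h1, h2, h4⟩ := exists_general_pair hhom hgcd h3 ms.toFinset
    (Φ := fun o => lineEval (PairRing K) o R) (fun o _ => hR o) fun o ho =>
      exists_aeval_planeRep_ne_zero hhom h3 ((hne o).mpr (by simpa using ho))
  -- Row 1 enters neither pencil and only serves to make the matrix invertible.
  let A : Matrix (Fin 4) (Fin 4) K :=
    !![u 0, u 1, u 2, 0; 0, 0, 1, 0; v 0, v 1, v 2, 0; 0, 0, 0, 1]
  have hA : A.det ≠ 0 := by
    have : A.det = -(u 0 * v 1 - u 1 * v 0) := by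
      simp [A, Matrix.det_succ_row_zero, Fin.sum_univ_succ, Fin.succAbove]
      ring
    rw [this]
    exact neg_ne_zero.mpr h2
  have hp : ∀ ξ : Fin 4 → K, ξ 3 = 1 → pencil A 0 ξ = ![u 0, u 1, u 2, -ξ 0] ∧
      pencil A 2 ξ = ![v 0, v 1, v 2, -ξ 2] := fun ξ hξ => by
    constructor <;> ext j <;> fin_cases j <;> simp [pencil, A, hξ]
  refine ⟨Matrix.GeneralLinearGroup.mkOfDetNeZero A hA, ⟨rfl, fun i => ?_⟩, fun o => ?_⟩
  · fin_cases i <;> exact ⟨rfl, rfl⟩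
  change ∃ ξ : Fin 4 → K, pencilEval A ξ (lineEval (PairRing K) o R) ≠ 0
  by_cases ho : o ∈ ms
  -- At this x the two pencils are exactly `u` and `v`.
  · refine ⟨![-u 3, 0, -v 3, 1], ?_⟩
    have h5 := hp ![-u 3, 0, -v 3, 1] rfl
    have hu : (![u 0, u 1, u 2, u 3] : Fin 4 → K) = u := by ext j; fin_cases j <;> rfl
    have hv : (![v 0, v 1, v 2, v 3] : Fin 4 → K) = v := by ext j; fin_cases j <;> rfl
    change aeval (Sum.elim (pencil A 0 _) (pencil A 2 _)) _ ≠ 0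
    rw [h5.1, h5.2]
    simpa [hu, hv] using h1 o (by simpa using ho)
  -- Chosen so that the first member takes the value 1 at (0 : 0 : 1) and so has finitely many zeros
  -- over o.
  · set c : K := (∑ j : Fin 3, u j.castSucc * aeval (![0, 0, 1] : Fin 3 → K) (p j.castSucc) - 1) /
      eval ![0, 0, 1] (p 3) with hc
    let f := member p (![u 0, u 1, u 2, -c] : Fin 4 → K)
    have hf0 : eval ![0, 0, 1] f = 1 := by
      rw [eval_member, Fin.sum_univ_four]
      rw [Fin.sum_univ_three] at hc
      simp at hc ⊢
      rw [hc]
      field_simp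
      ring
    have hfin := finite_fibre_zeros (K := K) o
      (isHomogeneous_member hhom (![u 0, u 1, u 2, -c] : Fin 4 → K)) (by
        rw [hf0]; exact one_ne_zero)
    let β : K → K := fun s =>
      ∑ j : Fin 3, v j.castSucc * aeval (planeRep o s) (p j.castSucc)
    -- At a zero of the first member with `p 3` nonzero, this excludes the only e for which the
    -- second vanishes too. Where `p 3` vanishes, the general position of `u` and `v` applies for
    -- any e.
    obtain ⟨e, he⟩ := (hfin.image fun s => β s / aeval (planeRep o s) (p 3)).exists_notMem
    have h5 := hp ![c, 0, e, 1] rfl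
    have h6 : lineEval K o (memberRes d p (pencil A 0 ![c, 0, e, 1]) (pencil A 2 ![c, 0, e, 1]))
        ≠ 0 := by
      rw [h5.1, h5.2]
      refine (lineEval_memberRes_ne_zero_iff hhom o _ _ ?_).mpr fun s hs hs' => ?_
      · rw [eval_member] at hf0
        exact fun h => one_ne_zero (hf0.symm.trans h)
      · by_cases h7 : aeval (planeRep o s) (p 3) = 0
        · refine h4 o (by simpa using ho) s h7 ?_ ?_
          · rw [Fin.sum_univ_four] at hs
            rw [Fin.sum_univ_three]
            simpa [-coe_aeval_eq_eval, h7] using hs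
          · rw [Fin.sum_univ_four] at hs'
            rw [Fin.sum_univ_three]
            simpa [-coe_aeval_eq_eval, h7] using hs'
        · refine he ⟨s, ?_, ?_⟩
          · rw [Set.mem_ofPred_eq, eval_member]
            exact hs
          · rw [div_eq_iff h7]
            rw [Fin.sum_univ_four] at hs'
            simp [β, Fin.sum_univ_three] at hs' ⊢
            linear_combination hs'
    refine ⟨![c, 0, e, 1], fun h => h6 ?_⟩
    rw [← map_genericRes, hfac, map_mul, map_mul]
    refine mul_eq_zero_of_right _ ?_
    rw [lineEval_map (aeval _) o]
    exact h

end GeneralPosition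

/-! ### The content of the resultant -/

section Content

open MvPolynomial

variable {K : Type*} [Field K]

variable (K) in
/-- The identification of `K[x][t_1, t_2]` with `K[t_1, t_2][x]`. -/
def swapVars : MvPolynomial (Fin 2) (MvPolynomial (Fin 4) K) →+* CoeffRing K :=
  eval₂Hom (map C) fun i => C (X i)

theorem swapVars_map (q : MvPolynomial (Fin 2) K) :
    swapVars K (map (algebraMap K (MvPolynomial (Fin 4) K)) q) = C q := by
  have : (swapVars K).comp (map (algebraMap K (MvPolynomial (Fin 4) K))) = C := by
    ext i <;> simp [swapVars, algebraMap_eq]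
  exact DFunLike.congr_fun this q

theorem eval_swapVars (ξ : Fin 4 → K) (f : MvPolynomial (Fin 2) (MvPolynomial (Fin 4) K)) :
    eval (fun i => C (ξ i)) (swapVars K f) = map (eval ξ) f := by
  have : (eval fun i => C (ξ i)).comp (swapVars K) = map (eval ξ) := by
    ext i <;> simp [swapVars]
  exact DFunLike.congr_fun this f

theorem map_swapVars_asPoly (f : MvPolynomial (Fin 3) K) :
    (asPoly (map (algebraMap K (MvPolynomial (Fin 4) K)) f)).map (swapVars K) = asPolyInT₃ f := by
  have : ((Polynomial.mapRingHom (swapVars K)).comp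
      (asPoly : MvPolynomial (Fin 3) (MvPolynomial (Fin 4) K) →ₐ[_] _).toRingHom).comp
      (map (algebraMap K (MvPolynomial (Fin 4) K))) =
      (asPolyInT₃ : MvPolynomial (Fin 3) K →ₐ[K] _).toRingHom := by
    ext i
    · simp [swapVars, algebraMap_eq]
    · fin_cases i <;> simp [asPoly, swapVars, asPolyInT₃]
  exact DFunLike.congr_fun this f

variable (p : Fin 4 → MvPolynomial (Fin 3) K) (M : GL (Fin 4) K) {d : ℕ}

/-- The coefficients of the linear form `x_3 L_k - x_k L_3` as polynomials in `x`. -/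
def genericPencil (k : Fin 4) : Fin 4 → MvPolynomial (Fin 4) K :=
  pencil (fun i j => C (M i j)) k X

theorem map_swapVars_asPoly_member (k : Fin 4) :
    (asPoly (member p (genericPencil M k))).map (swapVars K) =
      xVar K 3 * asPolyInT₃ (transformed M p k) - xVar K k * asPolyInT₃ (transformed M p 3) := by
  let Ψ : MvPolynomial (Fin 3) (MvPolynomial (Fin 4) K) →+* Polynomial (CoeffRing K) :=
    (Polynomial.mapRingHom (swapVars K)).comp asPoly.toRingHom
  have hΨC : ∀ c : MvPolynomial (Fin 4) K, Ψ (C c) = Polynomial.C (map C c) := fun c => by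
    simp [Ψ, asPoly, swapVars, algebraMap_eq]
  have hΨ : ∀ f : MvPolynomial (Fin 3) K,
      Ψ (map (algebraMap K (MvPolynomial (Fin 4) K)) f) = asPolyInT₃ f := map_swapVars_asPoly
  have hC : ∀ c : K, asPolyInT₃ (C c) = Polynomial.C (C (C c)) := fun c => by
    rw [← algebraMap_eq, AlgHom.commutes]; rfl
  have hcoef : ∀ j, (Polynomial.C (map C (genericPencil M k j)) : Polynomial (CoeffRing K)) =
      xVar K 3 * asPolyInT₃ (C (M k j)) - xVar K k * asPolyInT₃ (C (M 3 j)) := fun j => by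
    rw [hC, hC, genericPencil, pencil, map_sub, map_mul, map_mul, map_X, map_X, map_C, map_C,
      Polynomial.C_sub, Polynomial.C_mul, Polynomial.C_mul, xVar, xVar]
  change Ψ (member p (genericPencil M k)) = _
  rw [member, map_sum, transformed, transformed, map_sum, map_sum, Finset.mul_sum, Finset.mul_sum]
  refine Eq.trans ?_ (Finset.sum_sub_distrib (fun j => xVar K 3 * asPolyInT₃ (C (M k j) * p j))
    fun j => xVar K k * asPolyInT₃ (C (M 3 j) * p j))
  refine Finset.sum_congr rfl fun j _ => ?_
  rw [map_mul, map_mul, map_mul, hΨC, hΨ, hcoef]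
  have hring {A : Type _} [CommRing A] (a b c d e : A) :
      (a * b - c * d) * e = a * (b * e) - c * (d * e) := by
    ring
  exact hring (A := Polynomial (CoeffRing K)) _ _ _ _ _

variable {p M}

/-- At x = e_k the coefficient of t_3^d is -M_{33} times the value of `p 3` at (0 : 0 : 1). Hence
the actual degrees used in `resK` agree with the formal degree d. -/
theorem natDegree_map_swapVars (hhom : ∀ i, (p i).IsHomogeneous d)
    (h3 : eval ![0, 0, 1] (p 3) ≠ 0) (hM3 : M 3 3 ≠ 0)
    (hM : ∀ i : Fin 3, M 3 i.castSucc = 0) {k : Fin 4} (hk : k ≠ 3) :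
    ((asPoly (member p (genericPencil M k))).map (swapVars K)).natDegree = d := by
  refine le_antisymm (Polynomial.natDegree_map_le.trans
    (natDegree_asPoly_le (isHomogeneous_member hhom _)))
    (Polynomial.le_natDegree_of_ne_zero fun h0 => ?_)
  rw [Polynomial.coeff_map, coeff_asPoly_self (isHomogeneous_member hhom _)] at h0
  have hc : ∀ q : MvPolynomial (Fin 3) K,
      aeval (![0, 0, 1] : Fin 3 → MvPolynomial (Fin 4) K) q = C (eval ![0, 0, 1] q) := fun q => by
    have := aeval_algebraMap_apply (MvPolynomial (Fin 4) K) (![0, 0, 1] : Fin 3 → K) q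
    rw [← coe_aeval_eq_eval, RingHom.coe_coe, ← algebraMap_eq, ← this]
    congr 2
    ext i
    fin_cases i <;> simp
  have h1 := congrArg (eval fun i => C ((Pi.single k 1 : Fin 4 → K) i)) h0
  rw [eval_swapVars, map_C, map_zero, C_eq_zero, eval_member, map_sum, Fin.sum_univ_castSucc] at h1
  simp only [hc, map_mul, eval_C, genericPencil, pencil, hM] at h1
  simp [hk.symm] at h1
  exact h1.elim hM3 h3

theorem resK_eq (hhom : ∀ i, (p i).IsHomogeneous d)
    (h3 : eval ![0, 0, 1] (p 3) ≠ 0) (hM3 : M 3 3 ≠ 0)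
    (hM : ∀ i : Fin 3, M 3 i.castSucc = 0) :
    resK M p = swapVars K (memberRes d p (genericPencil M 0) (genericPencil M 2)) := by
  rw [resK, K₁, K₂, ← map_swapVars_asPoly_member, ← map_swapVars_asPoly_member,
    natDegree_map_swapVars hhom h3 hM3 hM (by decide),
    natDegree_map_swapVars hhom h3 hM3 hM (by decide), Polynomial.resultant_map_map]
  rfl

theorem totalDegree_lineForm_prod (ms : Multiset (Option K)) :
    (ms.map lineForm).prod.totalDegree = Multiset.card ms := by
  induction ms using Multiset.induction with
  | empty => simp
  | cons o s ih =>
    have hs : (s.map lineForm).prod ≠ 0 := Multiset.prod_ne_zero fun h => by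
      obtain ⟨o', -, h⟩ := Multiset.mem_map.mp h
      exact (irreducible_lineForm o').ne_zero h
    rw [Multiset.map_cons, Multiset.prod_cons, Multiset.card_cons,
      totalDegree_mul_of_isDomain (irreducible_lineForm o).ne_zero hs, ih,
      (isHomogeneous_lineForm o).totalDegree (irreducible_lineForm o).ne_zero, add_comm]

/-- P divides the content. The cofactor `D` divides every specialization `G ξ`, so a nonunit `D`
would vanish at some o where, by hypothesis, some `G ξ` does not. -/
theorem resK_ne_zero_and_totalDegree_contentX [IsAlgClosed K] (hhom : ∀ i, (p i).IsHomogeneous d)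
    (h3 : eval ![0, 0, 1] (p 3) ≠ 0) (hM3 : M 3 3 ≠ 0)
    (hM : ∀ i : Fin 3, M 3 i.castSucc = 0) {ms : Multiset (Option K)}
    {R : MvPolynomial (Fin 2) (PairRing K)} {n : ℕ} (hRn : R.IsHomogeneous n)
    (hfac : genericRes d p = map (algebraMap K (PairRing K)) (ms.map lineForm).prod * R)
    (hR : ∀ o : Option K, ∃ ξ : Fin 4 → K,
      pencilEval (fun i j => M i j) ξ (lineEval (PairRing K) o R) ≠ 0) :
    resK M p ≠ 0 ∧ (contentX (resK M p)).totalDegree = Multiset.card ms := by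
  have hres : resK M p = C (ms.map lineForm).prod * swapVars K
      (map (pencilEval (fun i j => C (M i j)) X : PairRing K →ₐ[K] MvPolynomial (Fin 4) K).toRingHom
        R) := by
    rw [resK_eq hhom h3 hM3 hM, ← map_genericRes, hfac, map_mul, map_mul, map_map, ← swapVars_map]
    congr 3
    exact congrArg (fun φ : K →+* MvPolynomial (Fin 4) K => map (σ := Fin 2) φ)
      (AlgHom.comp_algebraMap (aeval
        (Sum.elim (genericPencil M 0) (genericPencil M 2)) : PairRing K →ₐ[K] _))
  set P := (ms.map lineForm).prod with hP
  have hP0 : P ≠ 0 := Multiset.prod_ne_zero fun h => by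
    obtain ⟨o', -, h⟩ := Multiset.mem_map.mp h
    exact (irreducible_lineForm o').ne_zero h
  let G : (Fin 4 → K) → MvPolynomial (Fin 2) K := fun ξ =>
    map (pencilEval (fun i j => M i j) ξ).toRingHom R
  have hev : ∀ ξ : Fin 4 → K, eval (fun i => C (ξ i)) (resK M p) = P * G ξ := fun ξ => by
    rw [hres, map_mul, eval_C, eval_swapVars, map_map]
    congr 3
    ext i
    · simp
    · rcases i with i | i <;> simp [pencilEval, pencil]
  have hG : ∀ o, ∃ ξ, lineEval K o (G ξ) ≠ 0 := fun o => by
    obtain ⟨ξ, hξ⟩ := hR o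
    exact ⟨ξ, by rwa [lineEval_map_pencilEval]⟩
  obtain ⟨ξ₀, hξ₀⟩ := hG none
  have hG0 : G ξ₀ ≠ 0 := fun h => hξ₀ (by rw [h, map_zero])
  refine ⟨fun h => mul_ne_zero hP0 hG0 (by rw [← hev, h, map_zero]), ?_⟩
  obtain ⟨D, hD⟩ : P ∣ contentX (resK M p) := (dvd_contentX_iff _ _).mpr fun m => by
    rw [hres, coeff_C_mul]
    exact dvd_mul_right _ _
  have hDG : ∀ ξ, D ∣ G ξ := fun ξ => by
    have h1 : C (P * D) ∣ resK M p :=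
      (C_dvd_iff_dvd_coeff _ _).mpr ((dvd_contentX_iff _ _).mp hD.symm.dvd)
    have h2 := map_dvd (eval fun i => C (ξ i)) h1
    rw [hev, eval_C] at h2
    exact (mul_dvd_mul_iff_left hP0).mp h2
  have hDu : IsUnit D := by
    by_contra hu
    obtain ⟨o, ho⟩ := exists_lineEval_eq_zero_of_dvd (hRn.map _) hG0 (hDG ξ₀) hu
    obtain ⟨ξ, hξ⟩ := hG o
    exact hξ (zero_dvd_iff.mp (ho ▸ map_dvd (lineEval K o) (hDG ξ)))
  obtain ⟨c, hc, rfl⟩ := isUnit_iff_eq_C_of_isReduced.mp hDu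
  rw [hD, mul_comm, totalDegree_mul_of_isDomain (C_ne_zero.mpr hc.ne_zero) hP0, totalDegree_C,
    zero_add, totalDegree_lineForm_prod]

end Content

/-! ### An open set of transformations -/

section OpenSet

open MvPolynomial

variable {K : Type*} [Field K]

theorem eval_mul_of_isHomogeneous {σ : Type*} {f : MvPolynomial σ K} {n : ℕ}
    (hf : f.IsHomogeneous n) (c : K) (v : σ → K) :
    eval (fun i => c * v i) f = c ^ n * eval v f := by
  simpa using aeval_mul_of_isHomogeneous hf c v

/-- `f` need not be homogeneous, so its nonvanishing is not a condition on projective classes;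
nonvanishing of some homogeneous component is. -/
theorem exists_isZariskiOpen (f : MvPolynomial (Fin 4 × Fin 4) K) :
    ∃ U : Set (Matrix.ProjGenLinGroup (Fin 4) K), IsZariskiOpen U ∧
      ∀ M : GL (Fin 4) K, Matrix.ProjGenLinGroup.mk M ∈ U ↔
        ∃ m, eval (fun ij : Fin 4 × Fin 4 => M ij.1 ij.2) (homogeneousComponent m f) ≠ 0 := by
  let U : Set (Matrix.ProjGenLinGroup (Fin 4) K) :=
    {g | ∃ M : GL (Fin 4) K, Matrix.ProjGenLinGroup.mk M = g ∧
      ∃ m, eval (fun ij : Fin 4 × Fin 4 => M ij.1 ij.2) (homogeneousComponent m f) ≠ 0}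
  have hU : ∀ M : GL (Fin 4) K, Matrix.ProjGenLinGroup.mk M ∈ U ↔
      ∃ m, eval (fun ij : Fin 4 × Fin 4 => M ij.1 ij.2) (homogeneousComponent m f) ≠ 0 := by
    refine fun M => ⟨?_, fun h => ⟨M, rfl, h⟩⟩
    rintro ⟨M', hM', m, hm⟩
    obtain ⟨u, rfl⟩ := Matrix.ProjGenLinGroup.mk_eq_mk_iff.mp hM'
    refine ⟨m, ?_⟩
    have e : (fun ij : Fin 4 × Fin 4 => (M' * Matrix.GeneralLinearGroup.scalar (Fin 4) u) ij.1 ij.2)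
        = fun ij => (u : K) * M' ij.1 ij.2 := by
      ext ij
      simp [mul_comm]
    rw [e, eval_mul_of_isHomogeneous (homogeneousComponent_isHomogeneous m f) (u : K)]
    exact mul_ne_zero (pow_ne_zero _ u.ne_zero) hm
  refine ⟨U, ⟨Set.range fun m => homogeneousComponent m f, ?_, fun M => ?_⟩, hU⟩
  · rintro _ ⟨m, rfl⟩
    exact ⟨m, homogeneousComponent_isHomogeneous m f⟩
  · rw [hU, Set.exists_range_iff]

/-- As a polynomial in c, f(c v) has the values at v of the homogeneous components as coefficients.
-/
theorem exists_eval_mul_ne_zero [Infinite K] {σ : Type*} {f : MvPolynomial σ K} {v : σ → K} {m : ℕ}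
    (h : eval v (homogeneousComponent m f) ≠ 0) : ∃ c : K, eval (fun i => c * v i) f ≠ 0 := by
  let q : Polynomial K := ∑ i ∈ Finset.range (f.totalDegree + 1),
    Polynomial.C (eval v (homogeneousComponent i f)) * Polynomial.X ^ i
  have hq : ∀ c, q.eval c = eval (fun i => c * v i) f := fun c => by
    conv_rhs => rw [← sum_homogeneousComponent f]
    rw [map_sum, Polynomial.eval_finsetSum]
    refine Finset.sum_congr rfl fun i _ => ?_
    rw [eval_mul_of_isHomogeneous (homogeneousComponent_isHomogeneous i f)]
    rw [Polynomial.eval_mul, Polynomial.eval_C, Polynomial.eval_pow, Polynomial.eval_X, mul_comm]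
  have hq0 : q ≠ 0 := fun h0 => by
    have h1 := congrArg (fun q => Polynomial.coeff q m) h0
    simp only [q, Polynomial.finsetSum_coeff, Polynomial.coeff_C_mul_X_pow, Polynomial.coeff_zero,
      Finset.sum_ite_eq, Finset.mem_range, ite_eq_right_iff] at h1
    by_cases hm : m < f.totalDegree + 1
    · exact h (h1 hm)
    · exact h (by rw [homogeneousComponent_eq_zero _ _ (by omega), map_zero])
  by_contra! h'
  exact hq0 (Polynomial.funext fun c => by rw [hq, h', Polynomial.eval_zero])

theorem exists_open_subset_gStar [IsAlgClosed K] {R : MvPolynomial (Fin 2) (PairRing K)} {n : ℕ}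
    (hR : R.IsHomogeneous n) {M : GL (Fin 4) K}
    (hM : M (Fin.last 3) (Fin.last 3) = 1 ∧
      ∀ i : Fin 3, M i.castSucc (Fin.last 3) = 0 ∧ M (Fin.last 3) i.castSucc = 0)
    (hMR : ∀ o : Option K, ∃ ξ : Fin 4 → K,
      pencilEval (fun i j => M i j) ξ (lineEval (PairRing K) o R) ≠ 0) :
    ∃ Ω : Set (Matrix.ProjGenLinGroup (Fin 4) K), IsZariskiOpenInGStar Ω ∧ Ω.Nonempty ∧
      ∀ L : GL (Fin 4) K, Matrix.ProjGenLinGroup.mk L ∈ Ω →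
        L 3 3 ≠ 0 ∧ (∀ i : Fin 3, L 3 i.castSucc = 0) ∧
        ∀ o : Option K, ∃ ξ : Fin 4 → K,
          pencilEval (fun i j => L i j) ξ (lineEval (PairRing K) o R) ≠ 0 := by
  obtain ⟨f, hf0, hf⟩ := exists_hypersurface hR hMR
  obtain ⟨U, hUo, hU⟩ := exists_isZariskiOpen f
  refine ⟨U ∩ GStar K, ⟨U, hUo, rfl⟩, ⟨Matrix.ProjGenLinGroup.mk M, (hU M).mpr ?_, M, rfl, hM⟩,
    fun L hL => ?_⟩
  · by_contra! h
    refine hf0 ?_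
    rw [← sum_homogeneousComponent f, map_sum]
    exact Finset.sum_eq_zero fun i _ => h i
  · obtain ⟨N, hN, hN1, hN2⟩ := hL.2
    obtain ⟨u, rfl⟩ := Matrix.ProjGenLinGroup.mk_eq_mk_iff.mp hN
    obtain ⟨m, hm⟩ := (hU _).mp hL.1
    obtain ⟨c, hc⟩ := exists_eval_mul_ne_zero hm
    refine ⟨?_, fun i => ?_, fun o => ?_⟩
    · have : N 3 3 = 1 := hN1
      simp [this]
    · have : N 3 i.castSucc = 0 := (hN2 i).2
      simp [this]
    · set L := N * Matrix.GeneralLinearGroup.scalar (Fin 4) u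
      obtain ⟨ξ, hξ⟩ := hf (fun i j => c * L i j) hc o
      -- The hypersurface condition is known only for the multiple c L; since the pencil is bilinear
      -- in matrix and x, the scalar moves to ξ.
      refine ⟨fun i => c * ξ i, ?_⟩
      have e : ∀ k, pencil (fun i j => L i j) k (fun i => c * ξ i) =
          pencil (fun i j => c * L i j) k ξ := fun k => by
        ext j
        simp only [pencil]
        ring
      rwa [pencilEval, e, e]

end OpenSet

/-! ### Common zeros of two generic members -/

section GenericMembers

open MvPolynomial

variable {K : Type*} [Field K]

theorem algebraicIndependent_genericVar : AlgebraicIndependent K (genericVar K) := by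
  let φ : PairRing K →ₐ[K] GenericField K :=
    (IsScalarTower.toAlgHom K (FractionRing (PairRing K)) (GenericField K)).comp
      (IsScalarTower.toAlgHom K (PairRing K) (FractionRing (PairRing K)))
  have hφ : (aeval (genericVar K) : PairRing K →ₐ[K] GenericField K) = φ := by
    ext i
    simp [φ, genericVar]
  rw [AlgebraicIndependent, hφ]
  exact (FaithfulSMul.algebraMap_injective (FractionRing (PairRing K)) (GenericField K)).comp
    (IsFractionRing.injective (PairRing K) (FractionRing (PairRing K)))

variable {p : Fin 4 → MvPolynomial (Fin 3) K} {d : ℕ}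

theorem aeval_fibre {S : Type*} [CommRing S] [Algebra K S] (o : Option K)
    (f : MvPolynomial (Fin 3) K) (s : S) :
    Polynomial.aeval s (fibre o f) = aeval (planeRep o s) f := by
  rw [← Polynomial.eval_map_algebraMap, aeval_def, ← eval_map, ← eval_fibre]
  congr 1
  rw [fibre, fibre, asPoly_map, Polynomial.map_map, Polynomial.map_map]
  congr 1
  ext i
  · simp [lineEval]
  · simp [lineEval]

theorem aeval_planeRep_algebraMap {S : Type*} [CommRing S] [Algebra K S] (o : Option K)
    (f : MvPolynomial (Fin 3) K) (τ : K) :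
    aeval (planeRep o (algebraMap K S τ)) f = algebraMap K S (aeval (planeRep o τ) f) := by
  rw [← aeval_fibre, ← aeval_fibre, Polynomial.aeval_algebraMap_apply]

theorem aeval_planeRep_mem {F : Type*} [Field F] [Algebra K F] {A : Subalgebra K F}
    {B : Subalgebra A F} (o : Option K) {s : F} (hs : s ∈ B) (f : MvPolynomial (Fin 3) K) :
    aeval (planeRep o s) f ∈ B := by
  have hK : ∀ c : K, algebraMap K F c ∈ B := fun c => B.algebraMap_mem (algebraMap K A c)
  have h : aeval (planeRep o s) f ∈ B.restrictScalars K := by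
    rw [← Subalgebra.mem_toSubsemiring]
    induction f using MvPolynomial.induction_on with
    | C c => simp
    | add f g hf hg => rw [map_add]; exact add_mem hf hg
    | mul_X f i hf =>
      rw [map_mul, aeval_X]
      refine mul_mem hf ?_
      fin_cases i
      · exact hK _
      · exact hK _
      · exact hs
  exact h

/-- The second equation makes s algebraic over K[y]. The x_i remain independent over the algebraic
closure of K[y], so the first equation forces every p_i to vanish at the point; then s is a root of
`p 3` on a line over `K`, hence in `K`. -/
theorem common_zero_of_algebraicIndependent [IsAlgClosed K] (hhom : ∀ i, (p i).IsHomogeneous d)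
    (h3 : eval ![0, 0, 1] (p 3) ≠ 0) {F : Type*} [Field F] [Algebra K F] {x y : Fin 4 → F}
    (hxy : AlgebraicIndependent K (Sum.elim x y)) {o : Option K} {s : F}
    (hx : ∑ i, x i * aeval (planeRep o s) (p i) = 0)
    (hy : ∑ i, y i * aeval (planeRep o s) (p i) = 0) :
    ∃ τ : K, algebraMap K F τ = s ∧ ∀ i, aeval (planeRep o τ) (p i) = 0 := by
  obtain ⟨hyK, hxA⟩ := AlgebraicIndependent.sumElim_iff.mp hxy
  set A := Algebra.adjoin K (Set.range y) with hA
  have hymem : ∀ i, y i ∈ A := fun i => Algebra.subset_adjoin ⟨i, rfl⟩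
  have hs : s ∈ Subalgebra.algebraicClosure A F := by
    refine ⟨∑ i, Polynomial.C (⟨y i, hymem i⟩ : A) * (fibre o (p i)).map (algebraMap K A),
      fun h => ?_, ?_⟩
    · have h1 := congrArg (fun q => ((Polynomial.coeff q d : A) : F)) h
      simp only [Polynomial.finsetSum_coeff, Polynomial.coeff_C_mul, Polynomial.coeff_map,
        coeff_fibre o (hhom _), Polynomial.coeff_zero] at h1
      -- The leading coefficient ∑ y_i p_i(0, 0, 1) is nonzero by linear independence of the y_i
      -- over `K`.
      have h2 := Fintype.linearIndependent_iff.mp hyK.linearIndependent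
        (fun i => eval ![0, 0, 1] (p i)) (by
          rw [← ZeroMemClass.coe_zero A, ← h1, AddSubmonoidClass.coe_finsetSum]
          refine Finset.sum_congr rfl fun i _ => ?_
          rw [Algebra.smul_def, mul_comm]
          rfl) 3
      exact h3 h2
    · rw [map_sum, ← hy]
      refine Finset.sum_congr rfl fun i _ => ?_
      rw [map_mul, Polynomial.aeval_C, Polynomial.aeval_map_algebraMap, aeval_fibre]
      rfl
  have hli := hxA.subalgebraAlgebraicClosure.linearIndependent
  have h0 : ∀ i, aeval (planeRep o s) (p i) = 0 := fun i => by
    have := Fintype.linearIndependent_iff.mp hli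
      (fun i => ⟨aeval (planeRep o s) (p i), aeval_planeRep_mem o hs (p i)⟩) (by
        rw [← hx]
        refine Finset.sum_congr rfl fun i _ => ?_
        rw [Algebra.smul_def, mul_comm]
        rfl) i
    exact congrArg Subtype.val this
  have halg : IsAlgebraic K s := by
    refine ⟨fibre o (p 3), fun h => h3 ?_, by rw [aeval_fibre, h0]⟩
    rw [← coeff_fibre o (hhom 3), h, Polynomial.coeff_zero]
  obtain ⟨τ, rfl⟩ := minpoly.mem_range_of_degree_eq_one K s
    (IsAlgClosed.degree_eq_one_of_irreducible K (minpoly.irreducible halg.isIntegral))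
  refine ⟨τ, rfl, fun i => ?_⟩
  have h := h0 i
  rwa [aeval_planeRep_algebraMap, map_eq_zero] at h

end GenericMembers

/-! ### The multiplicity of the base locus -/

section BaseLocusMultiplicity

open MvPolynomial

/-- The affine chart of the plane that contains the points over a given point of the line. -/
def lineIndex {K : Type*} (o : Option K) : Fin 3 := o.elim 1 fun _ => 0

theorem dehomogenize_lineIndex {K F : Type*} [Field F] (o : Option K) :
    (dehomogenize (lineIndex o) : MvPolynomial (Fin 3) F →ₐ[F] _) =
      aeval (o.elim ![X 0, 1, X 1] fun _ => ![1, X 0, X 1]) := by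
  rw [dehomogenize]
  congr 1
  ext1 i
  cases o <;> fin_cases i <;> rfl

theorem asPoly₂_dehomogenize {K F : Type*} [Field F] (o : Option K) (f : MvPolynomial (Fin 3) F) :
    asPoly₂ F (dehomogenize (lineIndex o) f) =
      (asPoly f).map (lineChart F o : MvPolynomial (Fin 2) F →+* Polynomial F) := by
  have : (asPoly₂ F : MvPolynomial (Fin 2) F →+* _).comp
      (dehomogenize (lineIndex o) : MvPolynomial (Fin 3) F →ₐ[F] _).toRingHom =
      (Polynomial.mapRingHom (lineChart F o : MvPolynomial (Fin 2) F →+* Polynomial F)).comp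
        (asPoly : MvPolynomial (Fin 3) F →ₐ[F] _).toRingHom := by
    ext i : 2
    · simp [asPoly, asPoly₂_C, algebraMap_eq, lineChart]
    · cases o <;> fin_cases i <;> simp [asPoly, dehomogenize_lineIndex, lineChart]
  exact DFunLike.congr_fun this f

variable {K : Type*} [Field K] {F : Type*} [Field F] [Algebra K F]

theorem planeRep_lineIndex (o : Option K) (s : F) : planeRep o s (lineIndex o) = 1 := by
  cases o <;> simp [planeRep, lineIndex, lineRep]

theorem eval_dehomogenize_lineIndex (o : Option K) (s : F) (f : MvPolynomial (Fin 3) F) :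
    eval ![algebraMap K F (lineCoord o), s] (dehomogenize (lineIndex o) f) =
      eval (planeRep o s) f := by
  have : (eval ![algebraMap K F (lineCoord o), s]).comp
      (dehomogenize (lineIndex o) : MvPolynomial (Fin 3) F →ₐ[F] _).toRingHom =
      eval (planeRep o s) := by
    ext i : 2
    · simp
    · cases o <;> fin_cases i <;>
        simp [dehomogenize_lineIndex, planeRep, lineRep, lineCoord]
  exact DFunLike.congr_fun this f

theorem affineCoord_planeRep (o : Option K) (s : F) {c : F} (hc : c ≠ 0) :
    affineCoord (lineIndex o) (c • planeRep o s) = ![algebraMap K F (lineCoord o), s] := by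
  ext i
  cases o <;> fin_cases i <;>
    simp [affineCoord, lineIndex, planeRep, lineRep, lineCoord, Fin.succAbove, hc]

variable {p : Fin 4 → MvPolynomial (Fin 3) K} {d : ℕ}

theorem W₁_eq_member : W₁ p = member p fun i => genericVar K (Sum.inl i) := rfl

theorem W₂_eq_member : W₂ p = member p fun i => genericVar K (Sum.inr i) := rfl

theorem isHomogeneous_W₁ (hhom : ∀ i, (p i).IsHomogeneous d) : (W₁ p).IsHomogeneous d :=
  isHomogeneous_member hhom _

theorem isHomogeneous_W₂ (hhom : ∀ i, (p i).IsHomogeneous d) : (W₂ p).IsHomogeneous d :=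
  isHomogeneous_member hhom _

theorem planeRep_ne_zero (o : Option K) (s : F) : planeRep o s ≠ 0 := fun h => by
  have := congrFun h (lineIndex o)
  rw [planeRep_lineIndex] at this
  exact one_ne_zero this

/-- The point of the plane with homogeneous coordinates `planeRep o s`. -/
def planePoint (z : Option K × K) : Projectivization K (Fin 3 → K) :=
  Projectivization.mk K (planeRep z.1 z.2) (planeRep_ne_zero _ _)

theorem planePoint_injective : Function.Injective (planePoint (K := K)) := by
  rintro ⟨o, s⟩ ⟨o', s'⟩ h
  obtain ⟨c, hc⟩ := (Projectivization.mk_eq_mk_iff' K _ _ _ _).mp h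
  have h0 := congrFun hc 0
  have h1 := congrFun hc 1
  have h2 := congrFun hc 2
  cases o <;> cases o' <;> simp [planeRep, lineRep] at h0 h1 h2 ⊢
  · rw [h1, one_mul] at h2
    exact h2.symm
  · rw [h0] at h1
    simp at h1
  · rw [h0, one_mul] at h1 h2
    exact ⟨h1.symm, h2.symm⟩

theorem planePoint_mem_basePoints_iff (hhom : ∀ i, (p i).IsHomogeneous d) (z : Option K × K) :
    planePoint z ∈ basePoints p ↔ ∀ i, aeval (planeRep z.1 z.2) (p i) = 0 := by
  obtain ⟨c, hc⟩ := Projectivization.exists_smul_eq_mk_rep K (planeRep z.1 z.2)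
    (planeRep_ne_zero z.1 z.2)
  have hc' : (planePoint z).rep = fun i => (c : K) * planeRep z.1 z.2 i := hc.symm
  refine forall_congr' fun i => ?_
  rw [hc', eval_mul_of_isHomogeneous (hhom i), mul_eq_zero_iff_left (pow_ne_zero _ c.ne_zero)]
  simp

/-- The only point outside the image of `planePoint` is (0 : 0 : 1), where `p 3` does not vanish. -/
theorem exists_planePoint_eq (hhom : ∀ i, (p i).IsHomogeneous d)
    (h3 : eval ![0, 0, 1] (p 3) ≠ 0) {A : Projectivization K (Fin 3 → K)} (hA : A ∈ basePoints p) :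
    ∃ z, planePoint z = A := by
  have key : ∀ z : Option K × K, (∃ c : K, c • planeRep z.1 z.2 = A.rep) → planePoint z = A := by
    rintro z ⟨c, hc⟩
    rw [planePoint, ← A.mk_rep, Eq.comm, Projectivization.mk_eq_mk_iff']
    exact ⟨c, hc⟩
  by_cases h0 : A.rep 0 = 0
  · by_cases h1 : A.rep 1 = 0
    · exfalso
      have e : A.rep = fun i => A.rep 2 * (![0, 0, 1] : Fin 3 → K) i := by
        ext i; fin_cases i <;> simp [h0, h1]
      have h2 := hA 3
      rw [e, eval_mul_of_isHomogeneous (hhom 3), mul_eq_zero, or_iff_left h3] at h2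
      refine A.rep_nonzero (e.trans ?_)
      rw [eq_zero_of_pow_eq_zero h2]
      ext i
      simp
    · refine ⟨(none, A.rep 2 / A.rep 1), key _ ⟨A.rep 1, ?_⟩⟩
      ext i; fin_cases i <;> simp [planeRep, lineRep, h0]
      field_simp
  · refine ⟨(some (A.rep 1 / A.rep 0), A.rep 2 / A.rep 0), key _ ⟨A.rep 0, ?_⟩⟩
    ext i; fin_cases i <;> simp [planeRep, lineRep] <;> field_simp

theorem basePointMultiplicity_planePoint (hhom : ∀ i, (p i).IsHomogeneous d) (z : Option K × K) :
    basePointMultiplicity p (planePoint z) = affineIntersectionMultiplicity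
      (dehomogenize (lineIndex z.1) (W₁ p)) (dehomogenize (lineIndex z.1) (W₂ p))
      ![algebraMap K (GenericField K) (lineCoord z.1), algebraMap K (GenericField K) z.2] := by
  obtain ⟨c, hc⟩ := Projectivization.exists_smul_eq_mk_rep K (planeRep z.1 z.2)
    (planeRep_ne_zero z.1 z.2)
  have hc0 : algebraMap K (GenericField K) c ≠ 0 := (map_ne_zero _).mpr c.ne_zero
  have e : genericCoord (planePoint z) = algebraMap K (GenericField K) c •
      planeRep z.1 (algebraMap K (GenericField K) z.2) := by
    have hc' : (planePoint z).rep = fun i => (c : K) * planeRep z.1 z.2 i := hc.symm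
    ext i
    rw [genericCoord, hc']
    fin_cases i <;> simp [planeRep]
  rw [basePointMultiplicity, intersectionMultiplicity_eq (j := lineIndex z.1) _ ?_
    (isHomogeneous_W₁ hhom) (isHomogeneous_W₂ hhom), e, affineCoord_planeRep _ _ hc0]
  rw [e, Pi.smul_apply, planeRep_lineIndex]
  simp

/-- After substituting the generic variables, R stays nonzero at o by algebraic independence. The
multiplicity of o in `ms` is therefore the order at o of the resultant of W_1 and W_2. -/
theorem count_eq_sum [IsAlgClosed K] [DecidableEq K] (hhom : ∀ i, (p i).IsHomogeneous d)
    (h3 : eval ![0, 0, 1] (p 3) ≠ 0) {ms : Multiset (Option K)}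
    {R : MvPolynomial (Fin 2) (PairRing K)}
    (hfac : genericRes d p = map (algebraMap K (PairRing K)) (ms.map lineForm).prod * R)
    (hR : ∀ o : Option K, lineEval (PairRing K) o R ≠ 0) (o : Option K) {Z : Finset K}
    (hZ : ∀ s, s ∈ Z ↔ ∀ i, aeval (planeRep o s) (p i) = 0) :
    (ms.count o : ℕ∞) = ∑ s ∈ Z, basePointMultiplicity p (planePoint (o, s)) := by
  have hind := algebraicIndependent_genericVar (K := K)
  let γ : PairRing K →ₐ[K] GenericField K := aeval (genericVar K)
  have hγ : γ = aeval (Sum.elim (fun i => genericVar K (Sum.inl i)) fun i =>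
      genericVar K (Sum.inr i)) := by
    ext i
    rcases i with i | i <;> simp [γ]
  have hRγ : lineEval (GenericField K) o (map γ.toRingHom R) ≠ 0 := by
    rw [lineEval_map γ o]
    exact (map_ne_zero_iff γ hind).mpr (hR o)
  have hmap : formRes d (W₁ p) (W₂ p) =
      map (algebraMap K (GenericField K)) (ms.map lineForm).prod * map γ.toRingHom R := by
    have h1 := map_genericRes (d := d) (p := p) (fun i => genericVar K (Sum.inl i))
      fun i => genericVar K (Sum.inr i)
    rw [← hγ, hfac, map_mul, map_map] at h1
    refine h1.symm.trans ?_
    congr 2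
    exact congrArg (fun φ : K →+* GenericField K => map (σ := Fin 2) φ) γ.comp_algebraMap
  have hres : (asPoly₂ _ (dehomogenize (lineIndex o) (W₁ p))).resultant
      (asPoly₂ _ (dehomogenize (lineIndex o) (W₂ p))) d d =
      lineChart (GenericField K) o (formRes d (W₁ p) (W₂ p)) := by
    rw [asPoly₂_dehomogenize, asPoly₂_dehomogenize, Polynomial.resultant_map_map]
    rfl
  have hdeg : ∀ f : MvPolynomial (Fin 3) (GenericField K), f.IsHomogeneous d →
      (asPoly₂ _ (dehomogenize (lineIndex o) f)).natDegree ≤ d := fun f hf => by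
    rw [asPoly₂_dehomogenize]
    exact Polynomial.natDegree_map_le.trans (natDegree_asPoly_le hf)
  have hc : eval ![0, 0, 1] (W₁ p) ≠ 0 := fun h => by
    rw [W₁_eq_member, eval_member] at h
    have h1 := Fintype.linearIndependent_iff.mp hind.linearIndependent
      (Sum.elim (fun i => eval ![0, 0, 1] (p i)) 0) (by
        rw [Fintype.sum_sum_type, ← add_zero (0 : GenericField K), ← h]
        congr 1
        · refine Finset.sum_congr rfl fun i _ => ?_
          have h2 : (![0, 0, 1] : Fin 3 → GenericField K) =
              algebraMap K (GenericField K) ∘ ![0, 0, 1] := by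
            ext i; fin_cases i <;> simp
          rw [h2, aeval_algebraMap_apply, Algebra.smul_def, mul_comm]
          simp
        · simp [h]) (Sum.inl 3)
    exact h3 h1
  have hcount := rootMultiplicity_lineChart_prod o ms hRγ
  rw [← hmap, ← hres] at hcount
  rw [← hcount, rootMultiplicity_resultant_eq_sum hc (hdeg _ (isHomogeneous_W₁ hhom)) ?_
    (hdeg _ (isHomogeneous_W₂ hhom)) ?_ _ (Z.map ⟨_, (algebraMap K (GenericField K)).injective⟩) ?_]
  · rw [Finset.sum_map]
    exact Finset.sum_congr rfl fun s _ => (basePointMultiplicity_planePoint hhom (o, s)).symm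
  · rw [asPoly₂_dehomogenize, Polynomial.coeff_map, coeff_asPoly_self (isHomogeneous_W₁ hhom)]
    exact (lineChart (GenericField K) o).commutes _
  · rw [hres, hmap]
    exact lineChart_prod_mul_ne_zero o ms hRγ
  · intro s
    rw [eval_dehomogenize_lineIndex, eval_dehomogenize_lineIndex, Finset.mem_map]
    constructor
    · rintro ⟨τ, hτ, rfl⟩
      have h0 : ∀ i, aeval (planeRep o (algebraMap K (GenericField K) τ)) (p i) = 0 := fun i => by
        rw [aeval_planeRep_algebraMap, (hZ τ).mp hτ i, map_zero]
      rw [W₁_eq_member, W₂_eq_member, eval_member, eval_member]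
      simp [h0]
    · rintro ⟨h1, h2⟩
      rw [W₁_eq_member, eval_member] at h1
      rw [W₂_eq_member, eval_member] at h2
      have hind' : AlgebraicIndependent K (Sum.elim (fun i => genericVar K (Sum.inl i)) fun i =>
        genericVar K (Sum.inr i)) := by
        rw [AlgebraicIndependent, ← hγ]
        exact hind
      obtain ⟨τ, hτ, h⟩ := common_zero_of_algebraicIndependent hhom h3 hind' h1 h2
      exact ⟨τ, (hZ τ).mpr h, hτ⟩

/-- Base points lie only over points of `ms`, finitely many over each, so the sum splits along the
fibres of the projection from (0 : 0 : 1). -/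
theorem baseLocusMultiplicity_eq_card [IsAlgClosed K] (hhom : ∀ i, (p i).IsHomogeneous d)
    (h3 : eval ![0, 0, 1] (p 3) ≠ 0) {ms : Multiset (Option K)}
    {R : MvPolynomial (Fin 2) (PairRing K)}
    (hfac : genericRes d p = map (algebraMap K (PairRing K)) (ms.map lineForm).prod * R)
    (hR : ∀ o : Option K, lineEval (PairRing K) o R ≠ 0) :
    baseLocusMultiplicity p = Multiset.card ms := by
  classical
  have hfin : ∀ o : Option K, {s : K | ∀ i, aeval (planeRep o s) (p i) = 0}.Finite := fun o =>
    (finite_fibre_zeros o (hhom 3) h3).subset fun s hs => by simpa using hs 3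
  let Z : Option K → Finset K := fun o => (hfin o).toFinset
  have hZ : ∀ o s, s ∈ Z o ↔ ∀ i, aeval (planeRep o s) (p i) = 0 := fun o s =>
    Set.Finite.mem_toFinset _
  let T : Finset (Option K × K) := ms.toFinset.biUnion fun o =>
    (Z o).map ⟨_, Prod.mk_right_injective o⟩
  have hT : ∀ z, z ∈ T ↔ planePoint z ∈ basePoints p := fun z => by
    rw [planePoint_mem_basePoints_iff hhom, ← hZ]
    simp only [T, Finset.mem_biUnion, Finset.mem_map, Function.Embedding.coeFn_mk,
      Multiset.mem_toFinset]
    constructor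
    · rintro ⟨o, -, s, hs, rfl⟩
      exact hs
    · refine fun h => ⟨z.1, ?_, z.2, h, rfl⟩
      by_contra hz
      obtain ⟨i, hi⟩ := exists_aeval_planeRep_ne_zero hhom h3 (o := z.1) (by
        rw [hfac, map_mul]
        exact mul_ne_zero (mt (lineEval_prod_eq_zero_iff z.1 ms).mp hz) (hR _)) z.2
      exact hi ((hZ _ _).mp h i)
  let e : T ≃ basePoints p := Equiv.ofBijective (fun z => ⟨planePoint z.1, (hT z.1).mp z.2⟩)
    ⟨fun z w h => Subtype.ext (planePoint_injective (congrArg Subtype.val h)), fun A => by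
      obtain ⟨z, hz⟩ := exists_planePoint_eq hhom h3 A.2
      exact ⟨⟨z, (hT z).mpr (hz ▸ A.2)⟩, Subtype.ext hz⟩⟩
  rw [baseLocusMultiplicity, ← e.tsum_eq]
  change ∑' z : T, basePointMultiplicity p (planePoint z.1) = _
  rw [Finset.tsum_subtype T fun z => basePointMultiplicity p (planePoint z), Finset.sum_biUnion]
  · rw [← Multiset.toFinset_sum_count_eq, Nat.cast_sum]
    refine Finset.sum_congr rfl fun o _ => ?_
    rw [Finset.sum_map, count_eq_sum hhom h3 hfac hR o (hZ o)]
    rfl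
  · intro o _ o' _ hne
    rw [Function.onFun, Finset.disjoint_left]
    intro z hz hz'
    obtain ⟨s, -, rfl⟩ := Finset.mem_map.mp hz
    obtain ⟨s', -, h⟩ := Finset.mem_map.mp hz'
    exact hne (congrArg Prod.fst h).symm

end BaseLocusMultiplicity

end BaseLocus

end

/-! ### Conclusion: multiplicity and content degree both equal `card ms` -/

theorem mainTheorem3 {K : Type*} [Field K] [IsAlgClosed K] [CharZero K]
    (p : Fin 4 → MvPolynomial (Fin 3) K) (d : ℕ)
    (hhom : ∀ i, (p i).IsHomogeneous d)
    (hgcd : ∀ q : MvPolynomial (Fin 3) K, (∀ i, q ∣ p i) → IsUnit q)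
    (hpt : ∀ i, MvPolynomial.eval ![0, 0, 1] (p i) ≠ 0) :
    ∃ Ω : Set (Matrix.ProjGenLinGroup (Fin 4) K),
      BaseLocus.IsZariskiOpenInGStar Ω ∧ Ω.Nonempty ∧
      ∀ L : GL (Fin 4) K, Matrix.ProjGenLinGroup.mk L ∈ Ω →
        BaseLocus.resK L p ≠ 0 ∧
        BaseLocus.baseLocusMultiplicity p =
          ((BaseLocus.contentX (BaseLocus.resK L p)).totalDegree : ℕ∞) := by
  classical
  obtain ⟨ms, n, R, hRn, hfac, hR⟩ := BaseLocus.exists_lineForm_factorization (K := K)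
    (BaseLocus.isHomogeneous_memberRes hhom _ _)
    (BaseLocus.genericRes_ne_zero hhom hgcd (hpt 3))
  obtain ⟨M, hM, hMR⟩ := BaseLocus.exists_general_matrix hhom hgcd (hpt 3) hfac hR
  obtain ⟨Ω, hΩ, hne, h⟩ := BaseLocus.exists_open_subset_gStar hRn hM hMR
  refine ⟨Ω, hΩ, hne, fun L hL => ?_⟩
  obtain ⟨hL1, hL2, hL3⟩ := h L hL
  obtain ⟨h1, h2⟩ := BaseLocus.resK_ne_zero_and_totalDegree_contentX hhom (hpt 3) hL1 hL2 hRn hfac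
    hL3
  exact ⟨h1, by rw [h2, BaseLocus.baseLocusMultiplicity_eq_card hhom (hpt 3) hfac hR]⟩
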